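/- For sets $A,B\subseteq\omega$ let $A\oplus B=\{2n:n\in A\}\cup\{2n+1:n\in B\}$ and let $A'$ be the Turing jump of $A$. A set $G$ is \emph{low over} $X$ if $(G\oplus X)'\le_T X'$. Finite subsets of $\omega$ are identified with their canonical indices when speaking of computability and of $\Delta^{0,X}_2$ (i.e. $\Delta^0_2$ relative to $X$) collections and functions. An \emph{array} is a sequence $D_0,D_1,\dots$ of non-empty finite subsets of $\omega$ with $\lim_n\min D_n=\infty$. A collection $\mathcal C$ of finite sets that is downward closed under inclusion is \emph{$X$-hyperimmune within $X$} if for every $X$-computable array $D_0,D_1,\dots$ of subsets of $X$ there is an $n$ with $D_n\in\mathcal C$. \textbf{Theorem.} Let $X\subseteq\omega$ be infinite. Let $\mathcal C_0$ and $\mathcal C_1$ be $\Delta^{0,X}_2$ collections of finite subsets of $\omega$, each downward closed under inclusion, such that $\mathcal C_0\cup\mathcal C_1$ is $X$-hyperimmune within $X$, and let $f$ be a $\Delta^{0,X}_2$ function from the finite subsets of $\omega$ to $\omega$. Then there are an $i<2$ and a sequence of non-empty finite sets $F_0,F_1,\dots\in\mathcal C_i$ such that \begin{itemize} \item $F_s\subseteq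 X$ for all $s$; \item $\max F_s<\min F_{s+1}$ for all $s$; \item $f(F_s)<\min F_{s+1}$ for all $s$; \item there is an infinite set $G\subseteq\bigcup_s F_s$ that is low over $X$. \end{itemize} -/

import Mathlib

/-- The characteristic function of a set of natural numbers. -/
noncomputable def charFun (A : Set ℕ) : ℕ → ℕ :=
  A.indicator 1

/-- `g` is computable from the set `A`. -/
def FunComputableFrom (A : Set ℕ) (g : ℕ → ℕ) : Prop :=
  ComputableIn {((charFun A : ℕ → ℕ) : ℕ →. ℕ)} g

/-- Turing reducibility `A ≤_T B` of sets. -/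
def SetTuringLE (A B : Set ℕ) : Prop :=
  FunComputableFrom B (charFun A)

/-- The join `A ⊕ B = {2n : n ∈ A} ∪ {2n + 1 : n ∈ B}`. -/
def setJoin (A B : Set ℕ) : Set ℕ :=
  (fun n => 2 * n) '' A ∪ (fun n => 2 * n + 1) '' B

/-- Programs with an oracle: the programs of `Nat.Partrec.Code` together with one further
instruction, `oracle`, which queries the oracle. -/
inductive OracleCode : Type
  | zero : OracleCode
  | succ : OracleCode
  | left : OracleCode
  | right : OracleCode
  | oracle : OracleCode
  | pair : OracleCode → OracleCode → OracleCode
  | comp : OracleCode → OracleCode → OracleCode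
  | prec : OracleCode → OracleCode → OracleCode
  | rfind' : OracleCode → OracleCode

namespace OracleCode

/-- The Gödel number of a program. -/
def encodeCode : OracleCode → ℕ
  | zero => 0
  | succ => 1
  | left => 2
  | right => 3
  | oracle => 4
  | pair cf cg => 2 * (2 * Nat.pair (encodeCode cf) (encodeCode cg)) + 5
  | comp cf cg => 2 * (2 * Nat.pair (encodeCode cf) (encodeCode cg) + 1) + 5
  | prec cf cg => (2 * (2 * Nat.pair (encodeCode cf) (encodeCode cg)) + 1) + 5
  | rfind' cf => (2 * (2 * encodeCode cf + 1) + 1) + 5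

/-- `eval A c` is the partial function computed by the program `c` with oracle `A`. All the
instructions other than `oracle` are interpreted as in `Nat.Partrec.Code.eval`. -/
noncomputable def eval (A : Set ℕ) : OracleCode → ℕ →. ℕ
  | zero => fun _ => Part.some 0
  | succ => fun n => Part.some (n + 1)
  | left => fun n => Part.some n.unpair.1
  | right => fun n => Part.some n.unpair.2
  | oracle => fun n => Part.some (charFun A n)
  | pair cf cg => fun n => Nat.pair <$> eval A cf n <*> eval A cg n
  | comp cf cg => fun n => eval A cg n >>= eval A cf
  | prec cf cg =>
    Nat.unpaired fun a n =>
      n.rec (eval A cf a) fun y IH => do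
        let i ← IH
        eval A cg (Nat.pair a (Nat.pair y i))
  | rfind' cf =>
    Nat.unpaired fun a m =>
      (Nat.rfind fun n => (fun k => decide (k = 0)) <$> eval A cf (Nat.pair a (n + m))).map (· + m)

end OracleCode

/-- The Turing jump `A' = {e : Φ_e^A(e) halts}`, where `Φ_e` is the program with Gödel
number `e`. -/
def turingJump (A : Set ℕ) : Set ℕ :=
  {e | ∃ c : OracleCode, c.encodeCode = e ∧ (c.eval A e).Dom}

/-- `G` is low over `X`: `(G ⊕ X)' ≤_T X'`. -/
def LowOver (G X : Set ℕ) : Prop :=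
  SetTuringLE (turingJump (setJoin G X)) (turingJump X)

/-- `S` is `Σ^{0,X}_2`: membership of `n` in `S` has the form `∃ a, ∀ b, R(n, a, b)` for an
`X`-computable relation `R`. -/
def IsSigma2In (X S : Set ℕ) : Prop :=
  ∃ R : Set ℕ, SetTuringLE R X ∧
    ∀ n, n ∈ S ↔ ∃ a, ∀ b, Nat.pair n (Nat.pair a b) ∈ R

/-- `S` is `Δ^{0,X}_2`: both `S` and its complement are `Σ^{0,X}_2`. -/
def IsDelta2In (X S : Set ℕ) : Prop :=
  IsSigma2In X S ∧ IsSigma2In X Sᶜ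

/-- The canonical index `∑_{x ∈ F} 2^x` of a finite set `F`; this is a bijection from the finite
sets of natural numbers to the natural numbers. -/
def canonicalIndex (F : Finset ℕ) : ℕ :=
  ∑ x ∈ F, 2 ^ x

/-- A collection of finite sets is `Δ^{0,X}_2` if the set of canonical indices of its members
is. -/
def IsDelta2Collection (X : Set ℕ) (C : Set (Finset ℕ)) : Prop :=
  IsDelta2In X (canonicalIndex '' C)

/-- A function on finite sets is `Δ^{0,X}_2` if its graph is, finite sets being given by their
canonical indices. -/
def IsDelta2Function (X : Set ℕ) (f : Finset ℕ → ℕ) : Prop :=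
  IsDelta2In X (Set.range fun F => Nat.pair (canonicalIndex F) (f F))

/-- An array: a sequence of (non-empty) finite sets with `min D_n → ∞`. -/
def IsArray (D : ℕ → Finset ℕ) : Prop :=
  ∃ h : ∀ n, (D n).Nonempty, Filter.Tendsto (fun n => (D n).min' (h n)) Filter.atTop Filter.atTop

/-- The collection `C` is `Z`-hyperimmune within `X`: every `Z`-computable array of subsets
of `X` has a term in `C`. -/
def HyperimmuneWithin (Z X : Set ℕ) (C : Set (Finset ℕ)) : Prop :=
  ∀ D : ℕ → Finset ℕ, IsArray D → FunComputableFrom Z (fun n => canonicalIndex (D n)) →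
    (∀ n, (D n : Set ℕ) ⊆ X) → ∃ n, D n ∈ C

/-! Two subsets of `X` are built together, one per side `i < 2`, by adding non-empty finite subsets
of `X` that lie in `C i` above a growing bound. Requirement `2e` asks that the `e`-th program halt
on `e` relative to the finite part joined with `X`; requirement `2j + 1` asks that the index of the
finite part be at least `j`. Stage `t` codes a pair `(k₀, k₁)` and treats `kᵢ` on a single side `i`:
either a set is added that meets `kᵢ`, or the bound is raised so far that no non-empty set above it
does.

Such an action always exists (`exists_isValidAct`). If not, then above every bound there are sets
`E₀`, `E₁` meeting the requirements of both sides, and `X` can search for them. The unions `E₀ ∪ E₁`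
form an `X`-computable array, so one of them lies in `C 0 ∪ C 1`, and downward closure puts `Eᵢ` in
`C i` for some `i`: a legal action after all. Since `X'` recognises legal actions, the run is
`X'`-computable (`exists_isRun`).

Some side has all its requirements treated (`IsRun.exists_side`). There the odd ones make the limit
`G` infinite, and the even ones decide `(G ⊕ X)'`: `X'` finds a stage treating `2e` and looks
whether anything was added (`IsRun.lowOver_limit`). This rests on the finite use of halting
computations (`HaltsWithin.mem_turingJump`, `exists_haltsWithin`). The sets added on that side are
the `F s`; the bound outgrows each set, its `f`-value and the use of the computation it secures. -/

open Encodable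

/-! ### Closure properties of relative computability -/

section ComputableInClosure

variable {α β γ σ : Type*} [Primcodable α] [Primcodable β] [Primcodable γ] [Primcodable σ]
  {O : Set (ℕ →. ℕ)}

theorem ComputableIn.of_eq {f g : α → σ} (hf : ComputableIn O f) (h : ∀ a, f a = g a) :
    ComputableIn O g :=
  (funext h : f = g) ▸ hf

theorem ComputableIn.comp {f : β → σ} {g : α → β} (hf : ComputableIn O f)
    (hg : ComputableIn O g) : ComputableIn O fun a => f (g a) :=
  Nat.RecursiveIn.of_eq (Nat.RecursiveIn.comp hf hg) fun n => by
    cases h : decode (α := α) n <;> simp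

theorem ComputableIn.pair {f : α → β} {g : α → γ} (hf : ComputableIn O f)
    (hg : ComputableIn O g) : ComputableIn O fun a => (f a, g a) :=
  Nat.RecursiveIn.of_eq (Nat.RecursiveIn.pair hf hg) fun n => by
    cases h : decode (α := α) n <;> simp [Seq.seq]

/-- Definition by recursion along the natural numbers. -/
theorem ComputableIn.nat_rec_const {h : ℕ × σ → σ} (hh : ComputableIn O h) (c : σ) :
    ComputableIn O fun n : ℕ => Nat.rec (motive := fun _ => σ) c (fun y i => h (y, i)) n := by
  have h0 : Nat.RecursiveIn O fun _ => Part.some (encode c) := by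
    exact
      RecursiveIn.iff_nat.1 (ComputableIn.const (O := O) (α := ℕ) (encode c)).recursiveIn
  have hr : Nat.RecursiveIn O fun n => (Part.some n.unpair.2 : Part ℕ) :=
    Nat.RecursiveIn.right
  have hp : Nat.RecursiveIn O fun n => Part.some (Nat.pair 0 n) := by
    exact RecursiveIn.iff_nat.1
      (Primrec₂.natPair.comp (Primrec.const 0) (Primrec.id (α := ℕ))).computableIn.recursiveIn
  refine Nat.RecursiveIn.of_eq (Nat.RecursiveIn.comp
    (Nat.RecursiveIn.prec h0 (Nat.RecursiveIn.comp hh hr)) hp) fun n => ?_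
  simp only [Part.bind_eq_bind, Part.bind_some, Nat.unpair_pair]
  induction n with
  | zero => simp
  | succ n ih =>
    change Part.bind _ _ = _
    rw [ih]
    simp

/-- The unbounded search operator. -/
theorem ComputableIn.rfind {p : α × ℕ → Bool} (hp : ComputableIn O p) :
    RecursiveIn O fun a => Nat.rfind fun n => Part.some (p (a, n)) := by
  -- `Nat.RecursiveIn.rfind` searches for a zero, so truth is coded by `0`.
  have h1 : ComputableIn O fun x => if p x then 0 else 1 :=
    (Primrec.cond Primrec.id (Primrec.const 0) (Primrec.const 1)).computableIn.comp hp
      |>.of_eq fun x => by cases p x <;> rfl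
  refine Nat.RecursiveIn.of_eq (Nat.RecursiveIn.rfind h1) fun n => ?_
  cases h : decode (α := α) n with
  | none =>
    simp only [Encodable.decode_prod_val, Nat.unpair_pair, h]
    refine (Part.eq_none_iff.2 fun x hx => ?_).trans (by simp)
    simpa using (Nat.mem_rfind.1 hx).1
  | some a =>
    simp only [Encodable.decode_prod_val, Nat.unpair_pair, h]
    simp
    exact (Part.map_id' (fun _ => rfl) _).symm

theorem ComputableIn.of_recursiveIn_tot {f : α →. σ} {g : α → σ} (hf : RecursiveIn O f)
    (h : ∀ a, g a ∈ f a) : ComputableIn O g :=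
  RecursiveIn.of_eq_tot hf h

open Classical in
/-- A predicate with a decision procedure using the oracles in `O`. -/
def DecidablePredIn (O : Set (ℕ →. ℕ)) (p : α → Prop) : Prop :=
  ComputableIn O fun a => decide (p a)

namespace DecidablePredIn

variable {p q : α → Prop}

theorem of_eq (hp : DecidablePredIn O p) (h : ∀ a, p a ↔ q a) : DecidablePredIn O q :=
  (funext fun a => propext (h a) : p = q) ▸ hp

theorem comp {p : β → Prop} {f : α → β} (hp : DecidablePredIn O p) (hf : ComputableIn O f) :
    DecidablePredIn O fun a => p (f a) :=
  ComputableIn.comp hp hf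

theorem not (hp : DecidablePredIn O p) : DecidablePredIn O fun a => ¬ p a :=
  (ComputableIn.comp Primrec.not.computableIn hp).of_eq fun a => by simp

theorem and (hp : DecidablePredIn O p) (hq : DecidablePredIn O q) :
    DecidablePredIn O fun a => p a ∧ q a :=
  (ComputableIn.comp Primrec.and.computableIn (ComputableIn.pair hp hq)).of_eq fun a => by
    by_cases h1 : p a <;> by_cases h2 : q a <;> simp [h1, h2]

theorem or (hp : DecidablePredIn O p) (hq : DecidablePredIn O q) :
    DecidablePredIn O fun a => p a ∨ q a :=
  (ComputableIn.comp Primrec.or.computableIn (ComputableIn.pair hp hq)).of_eq fun a => by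
    by_cases h1 : p a <;> by_cases h2 : q a <;> simp [h1, h2]

theorem of_primrec (hp : PrimrecPred p) : DecidablePredIn O p := by
  classical
  exact hp.decide.computableIn

theorem of_bool {f : α → Bool} (hf : ComputableIn O f) : DecidablePredIn O fun a => f a = true :=
  hf.of_eq fun a => by simp

open Classical in
theorem ite {f g : α → σ} (hp : DecidablePredIn O p) (hf : ComputableIn O f)
    (hg : ComputableIn O g) : ComputableIn O fun a => if p a then f a else g a :=
  ((Primrec.cond (Primrec.fst (α := Bool)) (Primrec.fst.comp Primrec.snd)
    (Primrec.snd.comp (Primrec.snd (β := σ × σ)))).computableIn.comp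
      (ComputableIn.pair hp (ComputableIn.pair hf hg))).of_eq fun a => by
    by_cases h : p a <;> simp [h]

/-- Search for a number satisfying a decidable predicate. -/
theorem exists_computableIn {p : α × ℕ → Prop} (hp : DecidablePredIn O p)
    (h : ∀ a, ∃ n, p (a, n)) : ∃ g : α → ℕ, ComputableIn O g ∧ ∀ a, p (a, g a) := by
  classical
  refine ⟨fun a => Nat.find (h a), ComputableIn.of_recursiveIn_tot (ComputableIn.rfind hp)
    fun a => ?_, fun a => Nat.find_spec (h a)⟩
  refine Nat.mem_rfind.2 ⟨by simpa using Nat.find_spec (h a), fun {m} hm => by simpa using Nat.find_min (h a) hm⟩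

end DecidablePredIn

end ComputableInClosure

/-! ### Sets as oracles -/

/-- The oracle given by a set of natural numbers. -/
noncomputable abbrev setOracle (A : Set ℕ) : Set (ℕ →. ℕ) :=
  {((charFun A : ℕ → ℕ) : ℕ →. ℕ)}

theorem charFun_of_mem {A : Set ℕ} {n : ℕ} (h : n ∈ A) : charFun A n = 1 := by
  simp [charFun, h]

theorem charFun_of_notMem {A : Set ℕ} {n : ℕ} (h : n ∉ A) : charFun A n = 0 := by
  simp [charFun, h]

theorem setTuringLE_iff {A B : Set ℕ} :
    SetTuringLE A B ↔ DecidablePredIn (setOracle B) fun n => n ∈ A := by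
  constructor
  · intro h
    refine (DecidablePredIn.of_primrec (p := fun n : ℕ => n = 1)
      (Primrec.eq.comp Primrec.id (Primrec.const 1))).comp h |>.of_eq fun n => ?_
    by_cases hn : n ∈ A <;> simp [charFun, hn]
  · intro h
    refine (h.ite (ComputableIn.const 1) (ComputableIn.const 0)).of_eq fun n => ?_
    by_cases hn : n ∈ A <;> simp [charFun, hn]

theorem decidablePredIn_mem (A : Set ℕ) : DecidablePredIn (setOracle A) fun n => n ∈ A :=
  setTuringLE_iff.1 (RecursiveIn.oracle _ rfl)

/-! ### Oracle programs and the use principle -/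

namespace OracleCode

/-- The partial function computed by a program with a partial function as its oracle. -/
noncomputable def evalWith (o : ℕ →. ℕ) : OracleCode → ℕ →. ℕ
  | zero => fun _ => Part.some 0
  | succ => fun n => Part.some (n + 1)
  | left => fun n => Part.some n.unpair.1
  | right => fun n => Part.some n.unpair.2
  | oracle => o
  | pair cf cg => fun n => Nat.pair <$> evalWith o cf n <*> evalWith o cg n
  | comp cf cg => fun n => evalWith o cg n >>= evalWith o cf
  | prec cf cg =>
    Nat.unpaired fun a n =>
      n.rec (evalWith o cf a) fun y IH => do
        let i ← IH
        evalWith o cg (Nat.pair a (Nat.pair y i))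
  | rfind' cf =>
    Nat.unpaired fun a m =>
      (Nat.rfind fun n => (fun k => decide (k = 0)) <$> evalWith o cf (Nat.pair a (n + m))).map
        (· + m)

theorem evalWith_charFun (A : Set ℕ) (c : OracleCode) :
    evalWith ((charFun A : ℕ → ℕ) : ℕ →. ℕ) c = eval A c := by
  induction c with
  | zero | succ | left | right | oracle => rfl
  | pair cf cg hf hg | comp cf cg hf hg | prec cf cg hf hg => simp only [evalWith, eval, hf, hg]; rfl
  | rfind' cf hf => simp only [evalWith, eval, hf]; rfl

section Mem

variable {o : ℕ →. ℕ} {cf cg : OracleCode} {n v : ℕ}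

theorem mem_evalWith_pair : v ∈ evalWith o (pair cf cg) n ↔
    ∃ x ∈ evalWith o cf n, ∃ y ∈ evalWith o cg n, Nat.pair x y = v := by
  simp [evalWith, Seq.seq]

theorem mem_evalWith_comp : v ∈ evalWith o (comp cf cg) n ↔
    ∃ x ∈ evalWith o cg n, v ∈ evalWith o cf x :=
  Part.mem_bind_iff

theorem mem_evalWith_prec_zero {a : ℕ} :
    v ∈ evalWith o (prec cf cg) (Nat.pair a 0) ↔ v ∈ evalWith o cf a := by
  simp [evalWith]

theorem mem_evalWith_prec_succ {a : ℕ} :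
    v ∈ evalWith o (prec cf cg) (Nat.pair a (n + 1)) ↔
      ∃ i ∈ evalWith o (prec cf cg) (Nat.pair a n),
        v ∈ evalWith o cg (Nat.pair a (Nat.pair n i)) := by
  simp [evalWith]

theorem mem_evalWith_rfind' {a m : ℕ} :
    v ∈ evalWith o (rfind' cf) (Nat.pair a m) ↔
      ∃ k, k + m = v ∧ 0 ∈ evalWith o cf (Nat.pair a (k + m)) ∧
        ∀ j < k, ∃ w ∈ evalWith o cf (Nat.pair a (j + m)), w ≠ 0 := by
  simp only [evalWith, Nat.unpaired, Nat.unpair_pair, Part.mem_map_iff]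
  constructor
  · rintro ⟨k, hk, rfl⟩
    obtain ⟨h1, h2⟩ := Nat.mem_rfind.1 hk
    refine ⟨k, rfl, by simpa using h1, fun j hj => ?_⟩
    simpa using h2 hj
  · rintro ⟨k, rfl, h1, h2⟩
    refine ⟨k, Nat.mem_rfind.2 ⟨by simpa using h1, fun {j} hj => ?_⟩, rfl⟩
    simpa using h2 j hj

end Mem

/-- The use principle: for a directed union of oracles, a halting computation is already a
computation with one of the oracles. -/
theorem exists_mem_evalWith_of_directed {o : ℕ → ℕ →. ℕ} {o' : ℕ →. ℕ}
    (hmono : ∀ u u', u ≤ u' → ∀ n v, v ∈ o u n → v ∈ o u' n)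
    (ho : ∀ n v, v ∈ o' n → ∃ u, v ∈ o u n) (c : OracleCode) :
    (∀ u u', u ≤ u' → ∀ n v, v ∈ evalWith (o u) c n → v ∈ evalWith (o u') c n) ∧
      ∀ n v, v ∈ evalWith o' c n → ∃ u, v ∈ evalWith (o u) c n := by
  induction c with
  | zero | succ | left | right => exact ⟨fun _ _ _ _ _ h => h, fun _ _ h => ⟨0, h⟩⟩
  | oracle => exact ⟨hmono, ho⟩
  | pair cf cg hf hg =>
    simp only [mem_evalWith_pair]
    refine ⟨fun u u' hu n v => ?_, fun n v => ?_⟩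
    · rintro ⟨x, hx, y, hy, rfl⟩
      exact ⟨x, hf.1 u u' hu _ _ hx, y, hg.1 u u' hu _ _ hy, rfl⟩
    · rintro ⟨x, hx, y, hy, rfl⟩
      obtain ⟨u, hu⟩ := hf.2 _ _ hx
      obtain ⟨u', hu'⟩ := hg.2 _ _ hy
      exact ⟨max u u', x, hf.1 _ _ (le_max_left _ _) _ _ hu, y,
        hg.1 _ _ (le_max_right _ _) _ _ hu', rfl⟩
  | comp cf cg hf hg =>
    simp only [mem_evalWith_comp]
    refine ⟨fun u u' hu n v => ?_, fun n v => ?_⟩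
    · rintro ⟨x, hx, hy⟩
      exact ⟨x, hg.1 u u' hu _ _ hx, hf.1 u u' hu _ _ hy⟩
    · rintro ⟨x, hx, hy⟩
      obtain ⟨u, hu⟩ := hg.2 _ _ hx
      obtain ⟨u', hu'⟩ := hf.2 _ _ hy
      exact ⟨max u u', x, hg.1 _ _ (le_max_left _ _) _ _ hu,
        hf.1 _ _ (le_max_right _ _) _ _ hu'⟩
  | prec cf cg hf hg =>
    have h1 : ∀ u u', u ≤ u' → ∀ n v, v ∈ evalWith (o u) (prec cf cg) n →
        v ∈ evalWith (o u') (prec cf cg) n := by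
      intro u u' hu p
      obtain ⟨⟨a, n⟩, rfl⟩ : ∃ q : ℕ × ℕ, Nat.pair q.1 q.2 = p := ⟨_, Nat.pair_unpair p⟩
      induction n with
      | zero =>
        simp only [mem_evalWith_prec_zero]
        exact hf.1 u u' hu a
      | succ n ih =>
        simp only [mem_evalWith_prec_succ]
        rintro v ⟨i, hi, hv⟩
        exact ⟨i, ih i hi, hg.1 u u' hu _ _ hv⟩
    refine ⟨h1, fun p => ?_⟩
    obtain ⟨⟨a, n⟩, rfl⟩ : ∃ q : ℕ × ℕ, Nat.pair q.1 q.2 = p := ⟨_, Nat.pair_unpair p⟩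
    induction n with
    | zero =>
      simp only [mem_evalWith_prec_zero]
      exact hf.2 a
    | succ n ih =>
      simp only [mem_evalWith_prec_succ]
      rintro v ⟨i, hi, hv⟩
      obtain ⟨u, hu⟩ := ih i hi
      obtain ⟨u', hu'⟩ := hg.2 _ _ hv
      exact ⟨max u u', i, h1 _ _ (le_max_left _ _) _ _ hu, hg.1 _ _ (le_max_right _ _) _ _ hu'⟩
  | rfind' cf hf =>
    refine ⟨fun u u' hu p => ?_, fun p => ?_⟩ <;>
    obtain ⟨⟨a, m⟩, rfl⟩ : ∃ q : ℕ × ℕ, Nat.pair q.1 q.2 = p := ⟨_, Nat.pair_unpair p⟩ <;>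
    simp only [mem_evalWith_rfind']
    · rintro v ⟨k, rfl, h0, hlt⟩
      refine ⟨k, rfl, hf.1 u u' hu _ _ h0, fun j hj => ?_⟩
      obtain ⟨w, hw, hw0⟩ := hlt j hj
      exact ⟨w, hf.1 u u' hu _ _ hw, hw0⟩
    · rintro v ⟨k, rfl, h0, hlt⟩
      obtain ⟨u, hu⟩ := hf.2 _ _ h0
      -- The finitely many failed tests before `k` need one common oracle, obtained by taking
      -- maxima.
      have h2 : ∀ l ≤ k, ∃ u', ∀ j < l, ∃ w ∈ evalWith (o u') cf (Nat.pair a (j + m)), w ≠ 0 := by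
        intro l
        induction l with
        | zero => exact fun _ => ⟨0, fun j hj => by omega⟩
        | succ l ih =>
          intro hl
          obtain ⟨u1, hu1⟩ := ih (by omega)
          obtain ⟨w, hw, hw0⟩ := hlt l (by omega)
          obtain ⟨u2, hu2⟩ := hf.2 _ _ hw
          refine ⟨max u1 u2, fun j hj => ?_⟩
          rcases Nat.lt_succ_iff_lt_or_eq.1 hj with hj | rfl
          · obtain ⟨w', hw', h0'⟩ := hu1 j hj
            exact ⟨w', hf.1 _ _ (le_max_left _ _) _ _ hw', h0'⟩
          · exact ⟨w, hf.1 _ _ (le_max_right _ _) _ _ hu2, hw0⟩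
      obtain ⟨u', hu'⟩ := h2 k le_rfl
      refine ⟨max u u', k, rfl, hf.1 _ _ (le_max_left _ _) _ _ hu, fun j hj => ?_⟩
      obtain ⟨w, hw, hw0⟩ := hu' j hj
      exact ⟨w, hf.1 _ _ (le_max_right _ _) _ _ hw, hw0⟩

theorem evalWith_mono {o o' : ℕ →. ℕ} (h : ∀ n v, v ∈ o n → v ∈ o' n) {c : OracleCode}
    {n v : ℕ} (hv : v ∈ evalWith o c n) : v ∈ evalWith o' c n :=
  -- Monotonicity is the use principle for the two-term chain `o ≤ o'`.
  (exists_mem_evalWith_of_directed (o := fun u => if u = 0 then o else o') (o' := o')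
    (fun u u' hu n v => by
      by_cases h0 : u = 0 <;> by_cases h1 : u' = 0 <;> simp [h0, h1]
      · exact h n v
      · omega)
    (fun n v hv => ⟨1, by simpa using hv⟩) c).1 0 1 zero_le_one n v (by simpa using hv)

/-- Programs compute all functions recursive in the oracle. -/
theorem exists_eval_eq {A : Set ℕ} {p : ℕ →. ℕ} (hp : Nat.RecursiveIn (setOracle A) p) :
    ∃ c : OracleCode, eval A c = p := by
  induction hp with
  | zero => exact ⟨zero, rfl⟩
  | succ => exact ⟨succ, rfl⟩
  | left => exact ⟨left, rfl⟩
  | right => exact ⟨right, rfl⟩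
  | oracle g hg => exact ⟨oracle, by rw [Set.mem_singleton_iff.1 hg]; rfl⟩
  | pair _ _ hf hg =>
    obtain ⟨cf, rfl⟩ := hf
    obtain ⟨cg, rfl⟩ := hg
    exact ⟨pair cf cg, rfl⟩
  | comp _ _ hf hg =>
    obtain ⟨cf, rfl⟩ := hf
    obtain ⟨cg, rfl⟩ := hg
    exact ⟨comp cf cg, rfl⟩
  | prec _ _ hf hg =>
    obtain ⟨cf, rfl⟩ := hf
    obtain ⟨cg, rfl⟩ := hg
    exact ⟨prec cf cg, rfl⟩
  | rfind _ hf =>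
    obtain ⟨cf, rfl⟩ := hf
    -- `pair left right` is the identity, and `zero` starts the search at `0`.
    refine ⟨comp (rfind' cf) (pair (pair left right) zero), funext fun n => ?_⟩
    simp only [eval, Seq.seq]
    simp [Part.map_id']

/-- A program with constant output. -/
def const : ℕ → OracleCode
  | 0 => zero
  | n + 1 => comp succ (const n)

@[simp] theorem eval_const (A : Set ℕ) (n m : ℕ) : eval A (const n) m = Part.some n := by
  induction n with
  | zero => rfl
  | succ n ih => simp [const, eval, ih]

theorem primrec_encodeCode_const : Primrec fun n => encodeCode (const n) := by
  have h : Primrec fun n : ℕ => Nat.rec (motive := fun _ => ℕ) 0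
      (fun _ i => 2 * (2 * Nat.pair 1 i + 1) + 5) n :=
    Primrec.nat_rec₁ 0 (Primrec₂.mk <| Primrec.nat_add.comp (Primrec.nat_mul.comp (Primrec.const 2)
      (Primrec.succ.comp (Primrec.nat_mul.comp (Primrec.const 2)
        (Primrec₂.natPair.comp (Primrec.const 1) Primrec.snd)))) (Primrec.const 5))
  refine h.of_eq fun n => ?_
  induction n with
  | zero => rfl
  | succ n ih => simp only [const, encodeCode, ← ih]

theorem encodeCode_injective : Function.Injective encodeCode := by
  intro c
  induction c with
  | zero | succ | left | right | oracle =>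
    intro d h
    cases d <;> simp only [encodeCode] at h <;> first | rfl | omega
  | pair cf cg hf hg | comp cf cg hf hg | prec cf cg hf hg =>
    intro d h
    cases d <;> simp only [encodeCode] at h <;> try omega
    rename_i df dg
    obtain ⟨h1, h2⟩ := Nat.pair_eq_pair.1 (show Nat.pair cf.encodeCode cg.encodeCode =
      Nat.pair df.encodeCode dg.encodeCode by omega)
    rw [hf h1, hg h2]
  | rfind' cf hf =>
    intro d h
    cases d <;> simp only [encodeCode] at h <;> try omega
    rename_i d
    rw [hf (show cf.encodeCode = d.encodeCode by omega)]

end OracleCode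

/-! ### The jump and Post's theorem -/

theorem encodeCode_mem_turingJump {A : Set ℕ} {c : OracleCode} :
    c.encodeCode ∈ turingJump A ↔ (c.eval A c.encodeCode).Dom := by
  refine ⟨fun ⟨d, hd, h⟩ => ?_, fun h => ⟨c, rfl, h⟩⟩
  rwa [OracleCode.encodeCode_injective hd] at h

section Jump

variable {α : Type*} [Primcodable α] {A : Set ℕ}

/-- The jump decides the predicates that are existential over the oracle. -/
theorem DecidablePredIn.exists_turingJump {p : α × ℕ → Prop}
    (hp : DecidablePredIn (setOracle A) p) :
    DecidablePredIn (setOracle (turingJump A)) fun a => ∃ n, p (a, n) := by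
  classical
  obtain ⟨c, hc⟩ := OracleCode.exists_eval_eq (ComputableIn.rfind hp)
  -- The program for the search at `a` ignores its input, so running it on its own Gödel number
  -- tests whether the search halts.
  have h1 : Primrec fun a : α =>
      ((OracleCode.comp c (OracleCode.const (encode a))).encodeCode : ℕ) :=
    Primrec.nat_add.comp (Primrec.nat_mul.comp (Primrec.const 2)
      (Primrec.succ.comp (Primrec.nat_mul.comp (Primrec.const 2)
        (Primrec₂.natPair.comp (Primrec.const c.encodeCode)
          (OracleCode.primrec_encodeCode_const.comp Primrec.encode))))) (Primrec.const 5)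
  refine ((decidablePredIn_mem (turingJump A)).comp h1.computableIn).of_eq fun a => ?_
  rw [encodeCode_mem_turingJump]
  simp only [OracleCode.eval, OracleCode.eval_const, Part.bind_eq_bind, Part.bind_some, hc,
    encodek]
  simp only [Part.coe_some, Part.bind_some]
  change (Nat.rfind fun n => Part.some (decide (p (a, n)))).Dom ↔ _
  rw [Part.dom_iff_mem]
  constructor
  · rintro ⟨n, hn⟩
    exact ⟨n, by simpa using (Nat.mem_rfind.1 hn).1⟩
  · intro h
    exact ⟨Nat.find h, Nat.mem_rfind.2 ⟨by simpa using Nat.find_spec h, fun {m} hm => by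
      simpa using Nat.find_min h hm⟩⟩

theorem DecidablePredIn.turingJump {p : α → Prop} (hp : DecidablePredIn (setOracle A) p) :
    DecidablePredIn (setOracle (turingJump A)) p :=
  (DecidablePredIn.exists_turingJump (hp.comp (ComputableIn.fst (β := ℕ)))).of_eq fun a => by simp

/-- The inner universal quantifier is absorbed by one jump. -/
theorem IsSigma2In.exists_decidablePredIn {X S : Set ℕ} (h : IsSigma2In X S) :
    ∃ Q : ℕ × ℕ → Prop, DecidablePredIn (setOracle (_root_.turingJump X)) Q ∧
      ∀ n, n ∈ S ↔ ∃ a, Q (n, a) := by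
  obtain ⟨R, hR, hS⟩ := h
  refine ⟨fun x => ∀ b, Nat.pair x.1 (Nat.pair x.2 b) ∈ R, ?_, hS⟩
  have h1 : DecidablePredIn (setOracle X) fun x : (ℕ × ℕ) × ℕ =>
      ¬ Nat.pair x.1.1 (Nat.pair x.1.2 x.2) ∈ R :=
    ((setTuringLE_iff.1 hR).comp (Primrec₂.natPair.comp (Primrec.fst.comp Primrec.fst)
      (Primrec₂.natPair.comp (Primrec.snd.comp Primrec.fst) Primrec.snd)).computableIn).not
  exact h1.exists_turingJump.not.of_eq fun x => by simp

/-- Post's theorem for `Δ₂` sets. -/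
theorem IsDelta2In.decidablePredIn {X S : Set ℕ} (h : IsDelta2In X S) :
    DecidablePredIn (setOracle (_root_.turingJump X)) fun n => n ∈ S := by
  obtain ⟨Q, hQ, hS⟩ := h.1.exists_decidablePredIn
  obtain ⟨Q', hQ', hS'⟩ := h.2.exists_decidablePredIn
  -- A witness for `S` or for its complement always turns up, and only one kind can.
  obtain ⟨g, hg, hg'⟩ := (hQ.or hQ').exists_computableIn fun n => by
    by_cases hn : n ∈ S
    · exact ((hS n).1 hn).imp fun a => Or.inl
    · exact ((hS' n).1 hn).imp fun a => Or.inr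
  refine (hQ.comp (ComputableIn.pair ComputableIn.id hg)).of_eq fun n => ⟨fun h => ?_, fun h => ?_⟩
  · exact (hS n).2 ⟨_, h⟩
  · exact (hg' n).resolve_right fun h' => (hS' n).2 ⟨_, h'⟩ h

end Jump

/-! ### Compiling oracle programs into ordinary programs -/

namespace OracleCode

open Nat.Partrec (Code)

/-- The map `((t, a), x) ↦ (t, (a, x))` of coded pairs. -/
def assocRightCode : Code :=
  .pair (.comp .left .left) (.pair (.comp .right .left) .right)

/-- The map `(t, (a, x)) ↦ ((t, a), x)` of coded pairs. -/
def assocLeftCode : Code :=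
  .pair (.pair .left (.comp .left .right)) (.comp .right .right)

/-- The program without an oracle that simulates a program whose oracle is computed by `q` from
a parameter, the parameter being the first component of the input. -/
def toCode (q : Code) : OracleCode → Code
  | zero => .zero
  | succ => .comp .succ .right
  | left => .comp .left .right
  | right => .comp .right .right
  | oracle => q
  | pair cf cg => .pair (toCode q cf) (toCode q cg)
  | comp cf cg => .comp (toCode q cf) (.pair .left (toCode q cg))
  | prec cf cg =>
    .comp (.prec (toCode q cf) (.comp (toCode q cg) assocRightCode)) assocLeftCode
  | rfind' cf => .comp (.rfind' (.comp (toCode q cf) assocRightCode)) assocLeftCode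

theorem some_bind_eq (a : ℕ) (f : ℕ →. ℕ) : (Part.some a >>= f) = f a :=
  Part.bind_some a f

theorem map_bind_eq (p : Part ℕ) (g : ℕ → ℕ) (f : ℕ →. ℕ) :
    (p.map g >>= f) = p >>= fun x => f (g x) :=
  Part.bind_map g p f

theorem eval_assocRightCode (t a x : ℕ) :
    assocRightCode.eval (Nat.pair (Nat.pair t a) x) = Part.some (Nat.pair t (Nat.pair a x)) := by
  simp [assocRightCode, Code.eval, Seq.seq, some_bind_eq]

theorem eval_assocLeftCode (t a x : ℕ) :
    assocLeftCode.eval (Nat.pair t (Nat.pair a x)) = Part.some (Nat.pair (Nat.pair t a) x) := by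
  simp [assocLeftCode, Code.eval, Seq.seq, some_bind_eq]

theorem eval_toCode (q : Code) (t : ℕ) (c : OracleCode) (n : ℕ) :
    (toCode q c).eval (Nat.pair t n) = evalWith (fun n => q.eval (Nat.pair t n)) c n := by
  induction c generalizing n with
  | zero | succ | left | right =>
    simp [toCode, Code.eval, evalWith, pure, PFun.pure, some_bind_eq]
  | oracle => rfl
  | pair cf cg hf hg => simp [toCode, Code.eval, evalWith, hf, hg]
  | comp cf cg hf hg =>
    have h : (fun x => (toCode q cf).eval (Nat.pair t x)) =
      evalWith (fun n => q.eval (Nat.pair t n)) cf := funext hf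
    simp only [toCode, Code.eval, evalWith, hg, Seq.seq]
    simp [map_bind_eq, h]
  | prec cf cg hf hg =>
    obtain ⟨⟨a, n⟩, rfl⟩ : ∃ q : ℕ × ℕ, Nat.pair q.1 q.2 = n := ⟨_, Nat.pair_unpair n⟩
    have h : ∀ m, (Code.prec (toCode q cf) (.comp (toCode q cg) assocRightCode)).eval
        (Nat.pair (Nat.pair t a) m) =
          evalWith (fun n => q.eval (Nat.pair t n)) (prec cf cg) (Nat.pair a m) := by
      intro m
      induction m with
      | zero => simp [Code.eval, evalWith, hf]
      | succ m ih =>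
        rw [Code.eval_prec_succ, ih]
        simp [Code.eval, evalWith, eval_assocRightCode, hg, some_bind_eq]
    simp only [toCode]
    rw [← h, Code.eval]
    simp [eval_assocLeftCode, some_bind_eq]
  | rfind' cf hf =>
    obtain ⟨⟨a, n⟩, rfl⟩ : ∃ q : ℕ × ℕ, Nat.pair q.1 q.2 = n := ⟨_, Nat.pair_unpair n⟩
    simp [toCode, Code.eval, evalWith, eval_assocLeftCode, eval_assocRightCode, hf, some_bind_eq]

/-- One step of the recursion that computes `toCode` on Gödel numbers. -/
def translateStep (q : Code) (n : ℕ) (F : ℕ → Code) : Code :=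
  if n = 0 then .zero
  else if n = 1 then .comp .succ .right
  else if n = 2 then .comp .left .right
  else if n = 3 then .comp .right .right
  else if n = 4 then q
  else if (n - 5) % 4 = 0 then
    .pair (F ((n - 5) / 4).unpair.1) (F ((n - 5) / 4).unpair.2)
  else if (n - 5) % 4 = 2 then
    .comp (F ((n - 5) / 4).unpair.1) (.pair .left (F ((n - 5) / 4).unpair.2))
  else if (n - 5) % 4 = 1 then
    .comp (.prec (F ((n - 5) / 4).unpair.1)
      (.comp (F ((n - 5) / 4).unpair.2) assocRightCode)) assocLeftCode
  else .comp (.rfind' (.comp (F ((n - 5) / 4)) assocRightCode)) assocLeftCode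

/-- `toCode` on Gödel numbers. -/
def translate (q : Code) (n : ℕ) : Code :=
  translateStep q n fun k => if _h : k < n then translate q k else .zero

theorem translateStep_pair (q : Code) (N : ℕ) (F : ℕ → Code) :
    translateStep q (2 * (2 * N) + 5) F = .pair (F N.unpair.1) (F N.unpair.2) := by
  simp only [translateStep, Nat.add_sub_cancel]
  rw [show 2 * (2 * N) / 4 = N by omega, show 2 * (2 * N) % 4 = 0 by omega]
  simp

theorem translateStep_comp (q : Code) (N : ℕ) (F : ℕ → Code) :
    translateStep q (2 * (2 * N + 1) + 5) F =
      .comp (F N.unpair.1) (.pair .left (F N.unpair.2)) := by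
  simp only [translateStep, Nat.add_sub_cancel]
  rw [show 2 * (2 * N + 1) / 4 = N by omega, show 2 * (2 * N + 1) % 4 = 2 by omega]
  simp

theorem translateStep_prec (q : Code) (N : ℕ) (F : ℕ → Code) :
    translateStep q (2 * (2 * N) + 1 + 5) F =
      .comp (.prec (F N.unpair.1) (.comp (F N.unpair.2) assocRightCode)) assocLeftCode := by
  simp only [translateStep, Nat.add_sub_cancel]
  rw [show (2 * (2 * N) + 1) / 4 = N by omega, show (2 * (2 * N) + 1) % 4 = 1 by omega]
  simp

theorem translateStep_rfind' (q : Code) (N : ℕ) (F : ℕ → Code) :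
    translateStep q (2 * (2 * N + 1) + 1 + 5) F =
      .comp (.rfind' (.comp (F N) assocRightCode)) assocLeftCode := by
  simp only [translateStep, Nat.add_sub_cancel]
  rw [show (2 * (2 * N + 1) + 1) / 4 = N by omega, show (2 * (2 * N + 1) + 1) % 4 = 3 by omega]
  simp

/-- Subprograms have smaller Gödel numbers, so the default `.zero` in `translate` is never reached.
-/
theorem translate_encodeCode (q : Code) (c : OracleCode) :
    translate q c.encodeCode = toCode q c := by
  induction c with
  | zero | succ | left | right | oracle =>
    rw [translate]
    simp [translateStep, encodeCode, toCode]
  | pair cf cg hf hg | comp cf cg hf hg | prec cf cg hf hg =>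
    have h1 := Nat.left_le_pair cf.encodeCode cg.encodeCode
    have h2 := Nat.right_le_pair cf.encodeCode cg.encodeCode
    rw [translate]
    simp only [encodeCode, toCode]
    first | rw [translateStep_pair] | rw [translateStep_comp] | rw [translateStep_prec]
    simp only [Nat.unpair_pair, hf, hg]
    rw [dif_pos (by omega), dif_pos (by omega)]
  | rfind' cf hf =>
    rw [translate]
    simp only [encodeCode, toCode]
    rw [translateStep_rfind']
    exact congrArg (fun x => ((Code.comp x assocRightCode).rfind'.comp assocLeftCode))
      ((dif_pos (by omega)).trans hf)

theorem primrec_translate (q : Code) : Primrec (translate q) := by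
  have hlen : Primrec fun L : List Code => L.length := Primrec.list_length
  have hm : Primrec fun L : List Code => (L.length - 5) / 4 :=
    Primrec.nat_div.comp (Primrec.nat_sub.comp hlen (Primrec.const 5)) (Primrec.const 4)
  have hr : Primrec fun L : List Code => (L.length - 5) % 4 :=
    Primrec.nat_mod.comp (Primrec.nat_sub.comp hlen (Primrec.const 5)) (Primrec.const 4)
  have hF : ∀ {k : List Code → ℕ}, Primrec k → Primrec fun L : List Code => L.getD (k L) Code.zero :=
    fun hk => (Primrec.list_getD Code.zero).comp Primrec.id hk
  have h1 := hF (Primrec.fst.comp (Primrec.unpair.comp hm))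
  have h2 := hF (Primrec.snd.comp (Primrec.unpair.comp hm))
  have heq : ∀ {k : List Code → ℕ}, Primrec k → ∀ j, PrimrecPred fun L => k L = j :=
    fun hk j => Primrec.eq.comp hk (Primrec.const j)
  -- Course-of-values recursion: `L` lists the earlier values, so its length is the current
  -- argument.
  have hstep : Primrec fun L : List Code =>
      translateStep q L.length fun k => L.getD k Code.zero := by
    refine Primrec.ite (heq hlen 0) (Primrec.const _) <|
      Primrec.ite (heq hlen 1) (Primrec.const _) <|
      Primrec.ite (heq hlen 2) (Primrec.const _) <|
      Primrec.ite (heq hlen 3) (Primrec.const _) <|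
      Primrec.ite (heq hlen 4) (Primrec.const _) <|
      Primrec.ite (heq hr 0) (Code.primrec₂_pair.comp h1 h2) <|
      Primrec.ite (heq hr 2)
        (Code.primrec₂_comp.comp h1 (Code.primrec₂_pair.comp (Primrec.const _) h2)) <|
      Primrec.ite (heq hr 1)
        (Code.primrec₂_comp.comp (Code.primrec₂_prec.comp h1
          (Code.primrec₂_comp.comp h2 (Primrec.const _))) (Primrec.const _)) <|
      Code.primrec₂_comp.comp (Code.primrec_rfind'.comp
        (Code.primrec₂_comp.comp (hF hm) (Primrec.const _))) (Primrec.const _)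
  have h : Primrec₂ fun (_ : Unit) n => translate q n :=
    Primrec.nat_strong_rec _ (Primrec.option_some.comp (hstep.comp Primrec.snd)).to₂ fun _ n => by
      rw [translate]
      simp only [List.length_map, List.length_range]
      congr 2
      funext k
      by_cases hk : k < n <;> simp [hk]
  exact h.comp (Primrec.const ()) Primrec.id

end OracleCode

/-! ### Finite oracles -/

section FiniteOracle

theorem primrec_pow : Primrec₂ ((· ^ ·) : ℕ → ℕ → ℕ) :=
  Primrec₂.unpaired'.1 Nat.Primrec.pow

theorem primrec_testBit : Primrec₂ Nat.testBit := by
  have h : PrimrecRel fun x i : ℕ => x / 2 ^ i % 2 = 1 :=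
    Primrec.eq.comp (Primrec.nat_mod.comp (Primrec.nat_div.comp Primrec.fst
      (primrec_pow.comp (Primrec.const 2) Primrec.snd)) (Primrec.const 2)) (Primrec.const 1)
  exact (PrimrecPred.decide h).of_eq fun p => (Nat.testBit_eq_decide_div_mod_eq).symm

/-- The join of the sets with indices `a` and `b` as an oracle that answers only queries
below `u`. -/
def joinOracle (a b u : ℕ) : ℕ →. ℕ := fun n =>
  ((if n < u then some (if n % 2 = 0 then (a.testBit (n / 2)).toNat
    else (b.testBit (n / 2)).toNat) else none : Option ℕ) : Part ℕ)

/-- The code is uniform in `a`, `b`, `u`, so one compiled program serves all finite oracles. -/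
theorem exists_joinOracle_code : ∃ q : Nat.Partrec.Code, ∀ a b u n,
    q.eval (Nat.pair (Nat.pair a (Nat.pair b u)) n) = joinOracle a b u n := by
  have hu : Primrec Nat.unpair := Primrec.unpair
  have ht : Primrec fun x : ℕ => x.unpair.1 := Primrec.fst.comp hu
  have hn : Primrec fun x : ℕ => x.unpair.2 := Primrec.snd.comp hu
  have hb := hn.comp ht
  have htb : Primrec fun b : Bool => b.toNat :=
    (Primrec.cond Primrec.id (Primrec.const 1) (Primrec.const 0)).of_eq fun b => by cases b <;> rfl
  have hhalf := Primrec.nat_div.comp hn (Primrec.const 2)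
  have h : Primrec fun x : ℕ =>
      (if x.unpair.2 < x.unpair.1.unpair.2.unpair.2 then
        some (if x.unpair.2 % 2 = 0 then (x.unpair.1.unpair.1.testBit (x.unpair.2 / 2)).toNat
          else (x.unpair.1.unpair.2.unpair.1.testBit (x.unpair.2 / 2)).toNat)
      else none : Option ℕ) :=
    Primrec.ite (Primrec.nat_lt.comp hn (hn.comp hb))
      (Primrec.option_some.comp (Primrec.ite
        (Primrec.eq.comp (Primrec.nat_mod.comp hn (Primrec.const 2)) (Primrec.const 0))
        (htb.comp (primrec_testBit.comp (ht.comp ht) hhalf))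
        (htb.comp (primrec_testBit.comp (ht.comp hb) hhalf))))
      (Primrec.const none)
  obtain ⟨q, hq⟩ := Nat.Partrec.Code.exists_code.1 (Partrec.nat_iff.1 h.to_comp.ofOption)
  exact ⟨q, fun a b u n => by rw [hq]; simp [joinOracle]⟩

end FiniteOracle

/-! ### Canonical indices and initial segments of `X` -/

section CanonicalIndex

/-- The finite set with a given canonical index. -/
def finsetOfIndex (n : ℕ) : Finset ℕ :=
  n.bitIndices.toFinset

theorem mem_finsetOfIndex {n x : ℕ} : x ∈ finsetOfIndex n ↔ n.testBit x = true := by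
  simp [finsetOfIndex]

theorem canonicalIndex_finsetOfIndex (n : ℕ) : canonicalIndex (finsetOfIndex n) = n :=
  Finset.sum_toFinset_bitIndices_two_pow n

theorem finsetOfIndex_canonicalIndex (F : Finset ℕ) : finsetOfIndex (canonicalIndex F) = F :=
  Finset.toFinset_bitIndices_sum_two_pow F

theorem testBit_canonicalIndex {F : Finset ℕ} {x : ℕ} :
    (canonicalIndex F).testBit x = true ↔ x ∈ F := by
  rw [← mem_finsetOfIndex, finsetOfIndex_canonicalIndex]

theorem lt_of_testBit {n x : ℕ} (h : n.testBit x = true) : x < n :=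
  x.lt_two_pow_self.trans_le (Nat.two_pow_le_of_mem_bitIndices (Nat.mem_bitIndices.2 h))

/-- Disjoint binary expansions add without carries; this lets the construction form unions by adding
indices. -/
theorem testBit_add_of_disjoint {a b : ℕ} (h : ∀ x, a.testBit x = true → b.testBit x ≠ true)
    (x : ℕ) : (a + b).testBit x = true ↔ a.testBit x = true ∨ b.testBit x = true := by
  have hd : Disjoint (finsetOfIndex a) (finsetOfIndex b) :=
    Finset.disjoint_left.2 fun x hx hx' => h x (mem_finsetOfIndex.1 hx) (mem_finsetOfIndex.1 hx')
  have : a + b = canonicalIndex (finsetOfIndex a ∪ finsetOfIndex b) := by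
    rw [canonicalIndex, Finset.sum_union hd]
    exact congrArg₂ _ (canonicalIndex_finsetOfIndex a).symm (canonicalIndex_finsetOfIndex b).symm
  rw [this, testBit_canonicalIndex, Finset.mem_union, mem_finsetOfIndex, mem_finsetOfIndex]

theorem finsetOfIndex_nonempty {n : ℕ} (h : n ≠ 0) : (finsetOfIndex n).Nonempty := by
  rw [Finset.nonempty_iff_ne_empty]
  intro h0
  apply h
  rw [← canonicalIndex_finsetOfIndex n, h0]
  simp [canonicalIndex]

open Classical in
/-- The canonical index of the part of `X` below `u`. -/
noncomputable def prefixIndex (X : Set ℕ) (u : ℕ) : ℕ :=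
  canonicalIndex ((Finset.range u).filter (· ∈ X))

theorem testBit_prefixIndex {X : Set ℕ} {u x : ℕ} :
    (prefixIndex X u).testBit x = true ↔ x < u ∧ x ∈ X := by
  simp [prefixIndex, testBit_canonicalIndex]

theorem computableIn_prefixIndex (X : Set ℕ) :
    ComputableIn (setOracle X) (prefixIndex X) := by
  have h1 : ComputableIn (setOracle X) fun x : ℕ × ℕ => charFun X x.1 :=
    ComputableIn.comp (f := charFun X) (RecursiveIn.oracle _ rfl) ComputableIn.fst
  have h2 : ComputableIn (setOracle X) fun x : ℕ × ℕ => x.2 + charFun X x.1 * 2 ^ x.1 :=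
    (Primrec.nat_add.comp (Primrec.snd.comp Primrec.fst)
      (Primrec.nat_mul.comp Primrec.snd (primrec_pow.comp (Primrec.const 2)
        (Primrec.fst.comp Primrec.fst)))).computableIn.comp
          (ComputableIn.pair ComputableIn.id h1)
  refine (h2.nat_rec_const 0).of_eq fun n => ?_
  induction n with
  | zero => simp [prefixIndex, canonicalIndex]
  | succ n ih =>
    simp only [ih]
    by_cases hn : n ∈ X
    · simp [prefixIndex, canonicalIndex, Finset.range_add_one, Finset.filter_insert, hn,
        charFun_of_mem hn, add_comm]
    · simp [prefixIndex, Finset.range_add_one, Finset.filter_insert, hn,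
        charFun_of_notMem hn]

end CanonicalIndex

namespace OracleCode

theorem encodeCode_surjective : Function.Surjective encodeCode := by
  intro n
  induction n using Nat.strong_induction_on with
  | _ n ih =>
    by_cases hn : n < 5
    · interval_cases n
      exacts [⟨zero, rfl⟩, ⟨succ, rfl⟩, ⟨left, rfl⟩, ⟨right, rfl⟩, ⟨oracle, rfl⟩]
    · have h1 := Nat.unpair_left_le ((n - 5) / 4)
      have h2 := Nat.unpair_right_le ((n - 5) / 4)
      obtain ⟨c1, hc1⟩ := ih ((n - 5) / 4).unpair.1 (by omega)
      obtain ⟨c2, hc2⟩ := ih ((n - 5) / 4).unpair.2 (by omega)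
      obtain ⟨c3, hc3⟩ := ih ((n - 5) / 4) (by omega)
      have h : (n - 5) % 4 = 0 ∨ (n - 5) % 4 = 1 ∨ (n - 5) % 4 = 2 ∨ (n - 5) % 4 = 3 := by omega
      rcases h with h | h | h | h
      · exact ⟨pair c1 c2, by simp only [encodeCode, hc1, hc2, Nat.pair_unpair]; omega⟩
      · exact ⟨prec c1 c2, by simp only [encodeCode, hc1, hc2, Nat.pair_unpair]; omega⟩
      · exact ⟨comp c1 c2, by simp only [encodeCode, hc1, hc2, Nat.pair_unpair]; omega⟩
      · exact ⟨rfind' c3, by simp only [encodeCode, hc3]; omega⟩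

end OracleCode

/-! ### Halting with finite use -/

section FiniteUse

theorem mem_joinOracle {G X : Set ℕ} {a u : ℕ} (h : ∀ x < u, x ∈ G ↔ a.testBit x = true)
    {n v : ℕ} : v ∈ joinOracle a (prefixIndex X u) u n ↔
      n < u ∧ v = charFun (setJoin G X) n := by
  by_cases hn : n < u
  · have hmod : n % 2 = 0 ∨ n % 2 = 1 := by omega
    have h2 := h (n / 2) (by omega)
    have h3 := testBit_prefixIndex (X := X) (u := u) (x := n / 2)
    rw [and_iff_right (show n / 2 < u by omega)] at h3
    have hmem : n ∈ setJoin G X ↔ if n % 2 = 0 then n / 2 ∈ G else n / 2 ∈ X := by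
      simp only [setJoin, Set.mem_union, Set.mem_image]
      constructor
      · rintro (⟨m, hm, rfl⟩ | ⟨m, hm, rfl⟩)
        · simpa using hm
        · rw [if_neg (by omega), show (2 * m + 1) / 2 = m by omega]
          exact hm
      · intro hm
        split_ifs at hm with h0
        · exact Or.inl ⟨n / 2, hm, by omega⟩
        · exact Or.inr ⟨n / 2, hm, by omega⟩
    have key : (if n % 2 = 0 then (a.testBit (n / 2)).toNat
        else ((prefixIndex X u).testBit (n / 2)).toNat) = charFun (setJoin G X) n := by
      by_cases hm : n ∈ setJoin G X
      · rw [charFun_of_mem hm]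
        rw [hmem] at hm
        split_ifs at hm ⊢
        · rw [h2.1 hm]; rfl
        · rw [h3.2 hm]; rfl
      · rw [charFun_of_notMem hm]
        rw [hmem] at hm
        split_ifs at hm ⊢
        · rw [Bool.eq_false_iff.2 (mt h2.2 hm)]; rfl
        · rw [Bool.eq_false_iff.2 (mt h3.1 hm)]; rfl
    simp only [joinOracle, if_pos hn, key]
    simp [hn]
  · simp [joinOracle, hn]

/-- A program computing the finite join oracle. -/
noncomputable def joinCode : Nat.Partrec.Code :=
  exists_joinOracle_code.choose

theorem eval_joinCode (a b u : ℕ) :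
    (fun n => joinCode.eval (Nat.pair (Nat.pair a (Nat.pair b u)) n)) = joinOracle a b u :=
  funext fun n => exists_joinOracle_code.choose_spec a b u n

/-- The `e`-th program halts on input `e`, with the oracle `F ⊕ X` where `F` is the finite set
with index `a`, asking only queries below `u.unpair.1` and within `u.unpair.2` steps. -/
def HaltsWithin (X : Set ℕ) (e a u : ℕ) : Prop :=
  (Nat.Partrec.Code.evaln u.unpair.2 (OracleCode.translate joinCode e)
    (Nat.pair (Nat.pair a (Nat.pair (prefixIndex X u.unpair.1) u.unpair.1)) e)).isSome = true

/-- `X` enters only through a finite prefix; the step-bounded evaluation is primitive recursive. -/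
theorem decidablePredIn_haltsWithin (X : Set ℕ) :
    DecidablePredIn (setOracle X) fun x : ℕ × ℕ × ℕ => HaltsWithin X x.1 x.2.1 x.2.2 := by
  have h1 : ComputableIn (setOracle X) fun x : ℕ × ℕ × ℕ => prefixIndex X x.2.2.unpair.1 :=
    (computableIn_prefixIndex X).comp (Primrec.fst.comp (Primrec.unpair.comp
      (Primrec.snd.comp Primrec.snd))).computableIn
  have hu : Primrec fun y : (ℕ × ℕ × ℕ) × ℕ => y.1.2.2.unpair :=
    Primrec.unpair.comp (Primrec.snd.comp (Primrec.snd.comp Primrec.fst))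
  have h3 : Primrec fun y : (ℕ × ℕ × ℕ) × ℕ =>
      ((y.1.2.2.unpair.2, OracleCode.translate joinCode y.1.1),
        Nat.pair (Nat.pair y.1.2.1 (Nat.pair y.2 y.1.2.2.unpair.1)) y.1.1) :=
    Primrec.pair (Primrec.pair (Primrec.snd.comp hu)
        ((OracleCode.primrec_translate joinCode).comp (Primrec.fst.comp Primrec.fst)))
      (Primrec₂.natPair.comp (Primrec₂.natPair.comp
        (Primrec.fst.comp (Primrec.snd.comp Primrec.fst))
        (Primrec₂.natPair.comp Primrec.snd (Primrec.fst.comp hu)))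
        (Primrec.fst.comp Primrec.fst))
  have h2 : Primrec fun y : (ℕ × ℕ × ℕ) × ℕ =>
      (Nat.Partrec.Code.evaln y.1.2.2.unpair.2 (OracleCode.translate joinCode y.1.1)
        (Nat.pair (Nat.pair y.1.2.1 (Nat.pair y.2 y.1.2.2.unpair.1)) y.1.1)).isSome :=
    Primrec.option_isSome.comp (Nat.Partrec.Code.primrec_evaln.comp
      (f := fun a => Nat.Partrec.Code.evaln a.1.1 a.1.2 a.2) h3)
  have h4 : ComputableIn (setOracle X) fun x : ℕ × ℕ × ℕ => (x, prefixIndex X x.2.2.unpair.1) :=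
    ComputableIn.pair ComputableIn.id h1
  have h5 := ComputableIn.comp h2.computableIn h4
  exact DecidablePredIn.of_bool h5

/-- The truncated oracle is a restriction of `G ⊕ X`, and enlarging an oracle preserves a halting
computation. -/
theorem HaltsWithin.mem_turingJump {G X : Set ℕ} {e a u : ℕ} (h : HaltsWithin X e a u)
    (hG : ∀ x < u, x ∈ G ↔ a.testBit x = true) : e ∈ turingJump (setJoin G X) := by
  obtain ⟨c, rfl⟩ := OracleCode.encodeCode_surjective e
  obtain ⟨v, hv⟩ := Option.isSome_iff_exists.1 h
  have hv' := Nat.Partrec.Code.evaln_sound hv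
  rw [OracleCode.translate_encodeCode, OracleCode.eval_toCode, eval_joinCode] at hv'
  refine ⟨c, rfl, Part.dom_iff_mem.2 ⟨v, ?_⟩⟩
  rw [← OracleCode.evalWith_charFun]
  refine OracleCode.evalWith_mono (fun n w hw => ?_) hv'
  rw [((mem_joinOracle fun x hx => hG x (hx.trans_le (Nat.unpair_left_le u))).1 hw).2]
  exact Part.mem_some _

/-- By the use principle a halting computation survives cutting the oracle at some `u₀`; any finite
set agreeing with `G` below `u₀` then serves as well. -/
theorem exists_haltsWithin {G X : Set ℕ} {e : ℕ} (h : e ∈ turingJump (setJoin G X)) :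
    ∃ u₀, ∀ a, (∀ x < u₀, x ∈ G ↔ a.testBit x = true) → ∃ u, HaltsWithin X e a u := by
  obtain ⟨c, rfl, hc⟩ := h
  obtain ⟨v, hv⟩ := Part.dom_iff_mem.1 hc
  rw [← OracleCode.evalWith_charFun] at hv
  obtain ⟨u₀, hu₀⟩ := (OracleCode.exists_mem_evalWith_of_directed
    (o := fun u n => ((if n < u then some (charFun (setJoin G X) n) else none : Option ℕ) : Part ℕ))
    (fun u u' hu n v => by
      by_cases h : n < u
      · simp [h, h.trans_le hu]
      · simp [h])
    (fun n v hv => ⟨n + 1, by simpa using hv⟩) c).2 _ _ hv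
  refine ⟨u₀, fun a ha => ?_⟩
  have h1 : v ∈ (OracleCode.translate joinCode c.encodeCode).eval
      (Nat.pair (Nat.pair a (Nat.pair (prefixIndex X u₀) u₀)) c.encodeCode) := by
    rw [OracleCode.translate_encodeCode, OracleCode.eval_toCode, eval_joinCode]
    refine OracleCode.evalWith_mono (fun n w hw => ?_) hu₀
    rw [mem_joinOracle ha]
    by_cases hn : n < u₀ <;> simp [hn] at hw
    exact ⟨hn, hw⟩
  obtain ⟨k, hk⟩ := Nat.Partrec.Code.evaln_complete.1 h1
  exact ⟨Nat.pair u₀ k, Option.isSome_iff_exists.2 ⟨v, by simpa using hk⟩⟩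

attribute [irreducible] HaltsWithin

end FiniteUse

/-! ### Requirements and actions -/

section Forcing

/-- The requirement numbered `k` on a finite set with index `a`: for odd `k` a lower bound on the
index, for even `k` the halting of the `k / 2`-th program. -/
def MeetsRequirement (X : Set ℕ) (k a u : ℕ) : Prop :=
  (k % 2 = 1 ∧ k / 2 ≤ a) ∨ (k % 2 = 0 ∧ HaltsWithin X (k / 2) a u)

/-- `E` is the index of a non-empty subset of `X` all of whose elements are at least `m`. -/
def IsIndexAbove (X : Set ℕ) (m E : ℕ) : Prop :=
  E ≠ 0 ∧ ∀ x, E.testBit x = true → x ∈ X ∧ m ≤ x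

/-- Adding the elements of `E`, all of them in `X` and at least `m`, meets requirement `k`. -/
def Forces (X : Set ℕ) (k a m E u : ℕ) : Prop :=
  IsIndexAbove X m E ∧ MeetsRequirement X k (a + E) u

theorem IsIndexAbove.mono {X : Set ℕ} {m m' E : ℕ} (h : m ≤ m') (hE : IsIndexAbove X m' E) :
    IsIndexAbove X m E :=
  ⟨hE.1, fun x hx => ⟨(hE.2 x hx).1, h.trans (hE.2 x hx).2⟩⟩

theorem primrecPred_testBit {α : Type*} [Primcodable α] {f g : α → ℕ} (hf : Primrec f)
    (hg : Primrec g) : PrimrecPred fun a => (f a).testBit (g a) = true :=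
  Primrec.eq.comp (primrec_testBit.comp hf hg) (Primrec.const true)

/-- Elements of a finite set are smaller than its index, so the quantifier is bounded and a prefix
of `X` suffices. -/
theorem decidablePredIn_isIndexAbove (X : Set ℕ) :
    DecidablePredIn (setOracle X) fun x : ℕ × ℕ => IsIndexAbove X x.1 x.2 := by
  have h1 : PrimrecRel fun (x : ℕ) (y : (ℕ × ℕ) × ℕ) =>
      ¬ y.1.2.testBit x = true ∨ (y.2.testBit x = true ∧ y.1.1 ≤ x) := by
    have hE : Primrec fun z : ℕ × (ℕ × ℕ) × ℕ => z.2.1.2 :=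
      Primrec.snd.comp (Primrec.fst.comp Primrec.snd)
    have hm : Primrec fun z : ℕ × (ℕ × ℕ) × ℕ => z.2.1.1 :=
      Primrec.fst.comp (Primrec.fst.comp Primrec.snd)
    exact (primrecPred_testBit hE Primrec.fst).not.or
      ((primrecPred_testBit (Primrec.snd.comp Primrec.snd) Primrec.fst).and
        (Primrec.nat_le.comp hm Primrec.fst))
  have h0 : PrimrecRel fun (n : ℕ) (y : (ℕ × ℕ) × ℕ) =>
      ∀ x < n, ¬ y.1.2.testBit x = true ∨ (y.2.testBit x = true ∧ y.1.1 ≤ x) :=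
    (h1.forall_mem_list.comp (Primrec.list_range.comp Primrec.fst) Primrec.snd).of_eq (by simp)
  have h0' : PrimrecPred fun y : (ℕ × ℕ) × ℕ =>
      ∀ x < y.1.2, ¬ y.1.2.testBit x = true ∨ (y.2.testBit x = true ∧ y.1.1 ≤ x) :=
    h0.comp (Primrec.snd.comp Primrec.fst) Primrec.id
  have h2 : PrimrecPred fun y : (ℕ × ℕ) × ℕ => ¬ y.1.2 = 0 ∧
      ∀ x < y.1.2, ¬ y.1.2.testBit x = true ∨ (y.2.testBit x = true ∧ y.1.1 ≤ x) :=
    (Primrec.eq.comp (Primrec.snd.comp Primrec.fst) (Primrec.const 0)).not.and h0'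
  have h3 : ComputableIn (setOracle X) fun x : ℕ × ℕ => (x, prefixIndex X x.2) :=
    ComputableIn.pair ComputableIn.id ((computableIn_prefixIndex X).comp ComputableIn.snd)
  refine ((DecidablePredIn.of_primrec h2).comp h3).of_eq fun x => ?_
  refine and_congr_right fun _ => ⟨fun h y hy => ?_, fun h y hy => ?_⟩
  · have := (h y (lt_of_testBit hy)).resolve_left (not_not.2 hy)
    exact ⟨(testBit_prefixIndex.1 this.1).2, this.2⟩
  · by_cases hb : x.2.testBit y = true
    · exact Or.inr ⟨testBit_prefixIndex.2 ⟨hy, (h y hb).1⟩, (h y hb).2⟩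
    · exact Or.inl hb

section

variable {α : Type*} [Primcodable α] {X : Set ℕ}

theorem DecidablePredIn.meetsRequirement {k a u : α → ℕ} (hk : Primrec k) (ha : Primrec a)
    (hu : Primrec u) :
    DecidablePredIn (setOracle X) fun x => MeetsRequirement X (k x) (a x) (u x) := by
  have hmod := Primrec.nat_mod.comp hk (Primrec.const 2)
  have hdiv := Primrec.nat_div.comp hk (Primrec.const 2)
  have h1 : PrimrecPred fun x => k x % 2 = 1 ∧ k x / 2 ≤ a x :=
    (Primrec.eq.comp hmod (Primrec.const 1)).and (Primrec.nat_le.comp hdiv ha)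
  have h2 : PrimrecPred fun x => k x % 2 = 0 := Primrec.eq.comp hmod (Primrec.const 0)
  exact (DecidablePredIn.of_primrec h1).or ((DecidablePredIn.of_primrec h2).and
    (DecidablePredIn.comp (f := fun x => (k x / 2, a x, u x)) (decidablePredIn_haltsWithin X)
      (hdiv.pair (ha.pair hu)).computableIn))

theorem DecidablePredIn.forces {k a m E u : α → ℕ} (hk : Primrec k) (ha : Primrec a)
    (hm : Primrec m) (hE : Primrec E) (hu : Primrec u) :
    DecidablePredIn (setOracle X) fun x => Forces X (k x) (a x) (m x) (E x) (u x) :=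
  ((decidablePredIn_isIndexAbove X).comp (hm.pair hE).computableIn).and
    (DecidablePredIn.meetsRequirement hk (Primrec.nat_add.comp ha hE) hu)

end

/-- The side of an action. -/
def actSide (v : ℕ) : Bool := decide (v.unpair.1 = 1)

/-- The index of the set that an action adds. -/
def actSet (v : ℕ) : ℕ := v.unpair.2.unpair.1

/-- The bound that accompanies an action. -/
def actUse (v : ℕ) : ℕ := v.unpair.2.unpair.2

theorem exists_act (i : Bool) (E u : ℕ) : ∃ v, actSide v = i ∧ actSet v = E ∧ actUse v = u :=
  ⟨Nat.pair i.toNat (Nat.pair E u), by cases i <;> simp [actSide], by simp [actSet],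
    by simp [actUse]⟩

theorem primrec_actSide : Primrec actSide :=
  PrimrecPred.decide (Primrec.eq.comp (Primrec.fst.comp Primrec.unpair) (Primrec.const 1))

theorem primrec_actSet : Primrec actSet :=
  Primrec.fst.comp (Primrec.unpair.comp (Primrec.snd.comp Primrec.unpair))

theorem primrec_actUse : Primrec actUse :=
  Primrec.snd.comp (Primrec.unpair.comp (Primrec.snd.comp Primrec.unpair))

/-- The component of a pair on a given side. -/
def onSide (i : Bool) (a b : ℕ) : ℕ := cond i b a

theorem primrec_onSide {α : Type*} [Primcodable α] {i : α → Bool} {a b : α → ℕ} (hi : Primrec i)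
    (ha : Primrec a) (hb : Primrec b) : Primrec fun x => onSide (i x) (a x) (b x) :=
  Primrec.cond hi hb ha

/-- The action `v` is allowed at stage `t` in the state `s`, which consists of the finite set
built on each side and of a lower bound for the elements to be added. Either the action adds a
member of the collection of its side and thereby meets the requirement, or it adds nothing and
raises the lower bound so that the requirement can no longer be met. -/
def IsValidAct (X : Set ℕ) (C : Bool → Set (Finset ℕ)) (t : ℕ) (s : ℕ × ℕ × ℕ) (v : ℕ) : Prop :=
  (finsetOfIndex (actSet v) ∈ C (actSide v) ∧
    Forces X (onSide (actSide v) t.unpair.1 t.unpair.2) (onSide (actSide v) s.1 s.2.1) s.2.2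
      (actSet v) (actUse v)) ∨
  (actSet v = 0 ∧ ∀ w : ℕ,
    ¬ Forces X (onSide (actSide v) t.unpair.1 t.unpair.2) (onSide (actSide v) s.1 s.2.1)
      (s.2.2 + actUse v) w.unpair.1 w.unpair.2)

/-- The state after an action. -/
def nextState (f : Finset ℕ → ℕ) (s : ℕ × ℕ × ℕ) (v : ℕ) : ℕ × ℕ × ℕ :=
  (s.1 + onSide (actSide v) (actSet v) 0, s.2.1 + onSide (actSide v) 0 (actSet v),
    s.2.2 + actUse v + actSet v + f (finsetOfIndex (actSet v)) + 1)

variable {X : Set ℕ} {C : Bool → Set (Finset ℕ)}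

/-- The only use of hyperimmunity. With no legal action, both requirements could be met above every
bound, giving an array of unions; a union caught in one collection yields a legal action on that
side. -/
theorem exists_isValidAct (hdown : ∀ i, IsLowerSet (C i))
    (hhyp : HyperimmuneWithin X X (C false ∪ C true)) (t : ℕ) (s : ℕ × ℕ × ℕ) :
    ∃ v, IsValidAct X C t s v := by
  by_contra! hno
  -- Raising the bound by `m` on side `i` is not a legal action, so a meeting set exists above it.
  have hex : ∀ i m, ∃ E u, Forces X (onSide i t.unpair.1 t.unpair.2) (onSide i s.1 s.2.1)
      (s.2.2 + m) E u := by
    intro i m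
    obtain ⟨v, hv1, hv2, hv3⟩ := exists_act i 0 m
    by_contra! h
    refine hno v (Or.inr ⟨hv2, fun w => ?_⟩)
    rw [hv1, hv3]
    exact h _ _
  -- `d (m, w)`: `w` codes a set and subsets of it that meet the requirements of the two sides
  let d : ℕ × ℕ → Prop := fun x =>
    (IsIndexAbove X (s.2.2 + x.1) x.2.unpair.1 ∧
      ∀ y < x.2, ¬ (x.2.unpair.2.unpair.1.unpair.1.testBit y = true ∨
        x.2.unpair.2.unpair.2.unpair.1.testBit y = true) ∨ x.2.unpair.1.testBit y = true) ∧
    (Forces X t.unpair.1 s.1 (s.2.2 + x.1) x.2.unpair.2.unpair.1.unpair.1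
        x.2.unpair.2.unpair.1.unpair.2 ∧
      Forces X t.unpair.2 s.2.1 (s.2.2 + x.1) x.2.unpair.2.unpair.2.unpair.1
        x.2.unpair.2.unpair.2.unpair.2)
  have hl : ∀ {α : Type} [Primcodable α] {g : α → ℕ}, Primrec g → Primrec fun x => (g x).unpair.1 :=
    fun hg => Primrec.fst.comp (Primrec.unpair.comp hg)
  have hr : ∀ {α : Type} [Primcodable α] {g : α → ℕ}, Primrec g → Primrec fun x => (g x).unpair.2 :=
    fun hg => Primrec.snd.comp (Primrec.unpair.comp hg)
  have hd : DecidablePredIn (setOracle X) d := by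
    have hw : Primrec fun x : ℕ × ℕ => x.2 := Primrec.snd
    have hm : Primrec fun x : ℕ × ℕ => s.2.2 + x.1 :=
      Primrec.nat_add.comp (Primrec.const _) Primrec.fst
    have hs : PrimrecRel fun (y w : ℕ) => ¬ (w.unpair.2.unpair.1.unpair.1.testBit y = true ∨
        w.unpair.2.unpair.2.unpair.1.testBit y = true) ∨ w.unpair.1.testBit y = true := by
      have hz : Primrec fun z : ℕ × ℕ => z.2 := Primrec.snd
      exact ((primrecPred_testBit (hl (hl (hr hz))) Primrec.fst).or
        (primrecPred_testBit (hl (hr (hr hz))) Primrec.fst)).not.or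
          (primrecPred_testBit (hl hz) Primrec.fst)
    exact (((decidablePredIn_isIndexAbove X).comp (hm.pair (hl hw)).computableIn).and
      (DecidablePredIn.of_primrec (hs.forall_lt.comp hw hw))).and
      ((DecidablePredIn.forces (Primrec.const _) (Primrec.const _) hm (hl (hl (hr hw)))
        (hr (hl (hr hw)))).and
      (DecidablePredIn.forces (Primrec.const _) (Primrec.const _) hm (hl (hr (hr hw)))
        (hr (hr (hr hw)))))
  have hdex : ∀ m, ∃ w, d (m, w) := by
    intro m
    obtain ⟨E₀, u₀, h0⟩ := hex false m
    obtain ⟨E₁, u₁, h1⟩ := hex true m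
    have hmem : ∀ y, (canonicalIndex (finsetOfIndex E₀ ∪ finsetOfIndex E₁)).testBit y = true ↔
        E₀.testBit y = true ∨ E₁.testBit y = true := fun y => by
      rw [testBit_canonicalIndex, Finset.mem_union, mem_finsetOfIndex, mem_finsetOfIndex]
    refine ⟨Nat.pair (canonicalIndex (finsetOfIndex E₀ ∪ finsetOfIndex E₁))
      (Nat.pair (Nat.pair E₀ u₀) (Nat.pair E₁ u₁)), ?_⟩
    simp only [d, Nat.unpair_pair]
    refine ⟨⟨⟨?_, fun y hy => ?_⟩, fun y _ => ?_⟩, h0, h1⟩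
    · obtain ⟨y, hy⟩ := finsetOfIndex_nonempty h0.1.1
      intro h
      have := (hmem y).2 (Or.inl (mem_finsetOfIndex.1 hy))
      rw [h] at this
      simp at this
    · rcases (hmem y).1 hy with hy | hy
      · exact h0.1.2 y hy
      · exact h1.1.2 y hy
    · rw [hmem]
      exact (em _).symm
  obtain ⟨g, hg, hgd⟩ := hd.exists_computableIn hdex
  have hne : ∀ m, (finsetOfIndex (g m).unpair.1).Nonempty := fun m =>
    finsetOfIndex_nonempty (hgd m).1.1.1
  -- The `m`-th set lies above `m`, so the minima tend to infinity.
  obtain ⟨m, hm⟩ := hhyp (fun m => finsetOfIndex (g m).unpair.1)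
    ⟨hne, Filter.tendsto_atTop_mono (fun m => Finset.le_min' _ _ _ fun y hy =>
      (Nat.le_add_left _ _).trans ((hgd m).1.1.2 y (mem_finsetOfIndex.1 hy)).2) Filter.tendsto_id⟩
    (((hl Primrec.id).computableIn.comp hg).of_eq fun m => (canonicalIndex_finsetOfIndex _).symm)
    (fun m y hy => ((hgd m).1.1.2 y (mem_finsetOfIndex.1 hy)).1)
  obtain ⟨⟨-, hsub⟩, h0, h1⟩ := hgd m
  -- The bounded quantifier in `d` loses nothing: an element of `E` is below `E`, hence below the
  -- code `g m`.
  have hsub' : ∀ E, (∀ y, E.testBit y = true →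
      (g m).unpair.2.unpair.1.unpair.1.testBit y = true ∨
        (g m).unpair.2.unpair.2.unpair.1.testBit y = true) → E ≤ g m →
      finsetOfIndex E ≤ finsetOfIndex (g m).unpair.1 := by
    intro E hE hle y hy
    rw [mem_finsetOfIndex] at hy ⊢
    exact (hsub y ((lt_of_testBit hy).trans_le hle)).resolve_left (not_not.2 (hE y hy))
  rcases hm with hm | hm
  · obtain ⟨v, hv1, hv2, hv3⟩ := exists_act false (g m).unpair.2.unpair.1.unpair.1
      (g m).unpair.2.unpair.1.unpair.2
    refine hno v (Or.inl ?_)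
    rw [hv1, hv2, hv3]
    exact ⟨hdown false (hsub' _ (fun y hy => Or.inl hy) ((Nat.unpair_left_le _).trans
      ((Nat.unpair_left_le _).trans (Nat.unpair_right_le _)))) hm,
      h0.1.mono (Nat.le_add_right _ _), h0.2⟩
  · obtain ⟨v, hv1, hv2, hv3⟩ := exists_act true (g m).unpair.2.unpair.2.unpair.1
      (g m).unpair.2.unpair.2.unpair.2
    refine hno v (Or.inl ?_)
    rw [hv1, hv2, hv3]
    exact ⟨hdown true (hsub' _ (fun y hy => Or.inr hy) ((Nat.unpair_left_le _).trans
      ((Nat.unpair_right_le _).trans (Nat.unpair_right_le _)))) hm,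
      h1.1.mono (Nat.le_add_right _ _), h1.2⟩

/-- The clause that nothing above the bound meets the requirement negates an existential over an
`X`-decidable relation, which costs one jump. -/
theorem decidablePredIn_isValidAct
    (hC : ∀ i, DecidablePredIn (setOracle (turingJump X)) fun n => finsetOfIndex n ∈ C i) :
    DecidablePredIn (setOracle (turingJump X))
      fun x : (ℕ × ℕ × ℕ × ℕ) × ℕ => IsValidAct X C x.1.1 x.1.2 x.2 := by
  have hside : Primrec fun x : (ℕ × ℕ × ℕ × ℕ) × ℕ => actSide x.2 :=
    primrec_actSide.comp Primrec.snd
  have hset : Primrec fun x : (ℕ × ℕ × ℕ × ℕ) × ℕ => actSet x.2 := primrec_actSet.comp Primrec.snd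
  have huse : Primrec fun x : (ℕ × ℕ × ℕ × ℕ) × ℕ => actUse x.2 := primrec_actUse.comp Primrec.snd
  have ht : Primrec fun x : (ℕ × ℕ × ℕ × ℕ) × ℕ => x.1.1.unpair :=
    Primrec.unpair.comp (Primrec.fst.comp Primrec.fst)
  have hs : Primrec fun x : (ℕ × ℕ × ℕ × ℕ) × ℕ => x.1.2 := Primrec.snd.comp Primrec.fst
  have hk := primrec_onSide hside (Primrec.fst.comp ht) (Primrec.snd.comp ht)
  have ha := primrec_onSide hside (Primrec.fst.comp hs) (Primrec.fst.comp (Primrec.snd.comp hs))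
  have hn := Primrec.snd.comp (Primrec.snd.comp hs)
  have h1 : DecidablePredIn (setOracle (turingJump X)) fun x : (ℕ × ℕ × ℕ × ℕ) × ℕ =>
      finsetOfIndex (actSet x.2) ∈ C (actSide x.2) := by
    have hi : ∀ i, DecidablePredIn (setOracle (turingJump X)) fun x : (ℕ × ℕ × ℕ × ℕ) × ℕ =>
        actSide x.2 = i ∧ finsetOfIndex (actSet x.2) ∈ C i := fun i =>
      (DecidablePredIn.of_primrec (Primrec.eq.comp hside (Primrec.const i))).and
        ((hC i).comp hset.computableIn)
    refine ((hi true).or (hi false)).of_eq fun x => ?_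
    cases actSide x.2 <;> simp
  have hw : Primrec fun y : ((ℕ × ℕ × ℕ × ℕ) × ℕ) × ℕ => y.2.unpair :=
    Primrec.unpair.comp Primrec.snd
  have h2 : DecidablePredIn (setOracle X) fun y : ((ℕ × ℕ × ℕ × ℕ) × ℕ) × ℕ =>
      Forces X (onSide (actSide y.1.2) y.1.1.1.unpair.1 y.1.1.1.unpair.2)
        (onSide (actSide y.1.2) y.1.1.2.1 y.1.1.2.2.1) (y.1.1.2.2.2 + actUse y.1.2)
        y.2.unpair.1 y.2.unpair.2 :=
    DecidablePredIn.forces (hk.comp Primrec.fst) (ha.comp Primrec.fst)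
      (Primrec.nat_add.comp (hn.comp Primrec.fst) (huse.comp Primrec.fst))
      (Primrec.fst.comp hw) (Primrec.snd.comp hw)
  have h3 : DecidablePredIn (setOracle X) fun x : (ℕ × ℕ × ℕ × ℕ) × ℕ =>
      Forces X (onSide (actSide x.2) x.1.1.unpair.1 x.1.1.unpair.2)
        (onSide (actSide x.2) x.1.2.1 x.1.2.2.1) x.1.2.2.2 (actSet x.2) (actUse x.2) :=
    DecidablePredIn.forces hk ha hn hset huse
  have h4 : PrimrecPred fun x : (ℕ × ℕ × ℕ × ℕ) × ℕ => actSet x.2 = 0 :=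
    Primrec.eq.comp hset (Primrec.const 0)
  have h5 := (h1.and h3.turingJump).or
    ((DecidablePredIn.of_primrec h4).and h2.exists_turingJump.not)
  refine h5.of_eq fun x => ?_
  simp only [IsValidAct, not_exists]

theorem computableIn_nextState {f : Finset ℕ → ℕ} {O : Set (ℕ →. ℕ)}
    (hf : ComputableIn O fun n => f (finsetOfIndex n)) :
    ComputableIn O fun x : (ℕ × ℕ × ℕ) × ℕ => nextState f x.1 x.2 := by
  have hside : Primrec fun y : ((ℕ × ℕ × ℕ) × ℕ) × ℕ => actSide y.1.2 :=
    primrec_actSide.comp (Primrec.snd.comp Primrec.fst)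
  have hset : Primrec fun y : ((ℕ × ℕ × ℕ) × ℕ) × ℕ => actSet y.1.2 :=
    primrec_actSet.comp (Primrec.snd.comp Primrec.fst)
  have huse : Primrec fun y : ((ℕ × ℕ × ℕ) × ℕ) × ℕ => actUse y.1.2 :=
    primrec_actUse.comp (Primrec.snd.comp Primrec.fst)
  have hs : Primrec fun y : ((ℕ × ℕ × ℕ) × ℕ) × ℕ => y.1.1 := Primrec.fst.comp Primrec.fst
  have ha : Primrec fun y : ((ℕ × ℕ × ℕ) × ℕ) × ℕ =>
      y.1.1.1 + onSide (actSide y.1.2) (actSet y.1.2) 0 :=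
    Primrec.nat_add.comp (Primrec.fst.comp hs) (primrec_onSide hside hset (Primrec.const 0))
  have hb : Primrec fun y : ((ℕ × ℕ × ℕ) × ℕ) × ℕ =>
      y.1.1.2.1 + onSide (actSide y.1.2) 0 (actSet y.1.2) :=
    Primrec.nat_add.comp (Primrec.fst.comp (Primrec.snd.comp hs))
      (primrec_onSide hside (Primrec.const 0) hset)
  have hc : Primrec fun y : ((ℕ × ℕ × ℕ) × ℕ) × ℕ =>
      y.1.1.2.2 + actUse y.1.2 + actSet y.1.2 + y.2 + 1 :=
    Primrec.nat_add.comp (Primrec.nat_add.comp (Primrec.nat_add.comp (Primrec.nat_add.comp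
      (Primrec.snd.comp (Primrec.snd.comp hs)) huse) hset) Primrec.snd) (Primrec.const 1)
  have h1 : Primrec fun y : ((ℕ × ℕ × ℕ) × ℕ) × ℕ =>
      (y.1.1.1 + onSide (actSide y.1.2) (actSet y.1.2) 0,
        y.1.1.2.1 + onSide (actSide y.1.2) 0 (actSet y.1.2),
        y.1.1.2.2 + actUse y.1.2 + actSet y.1.2 + y.2 + 1) := ha.pair (hb.pair hc)
  have h5 : ComputableIn O fun x : (ℕ × ℕ × ℕ) × ℕ => actSet x.2 :=
    Primrec.computableIn (primrec_actSet.comp Primrec.snd)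
  have h2 : ComputableIn O fun x : (ℕ × ℕ × ℕ) × ℕ => f (finsetOfIndex (actSet x.2)) :=
    hf.comp h5
  have h3 : ComputableIn O fun x : (ℕ × ℕ × ℕ) × ℕ => (x, f (finsetOfIndex (actSet x.2))) :=
    ComputableIn.pair ComputableIn.id h2
  have h4 := ComputableIn.comp h1.computableIn h3
  exact h4

end Forcing

/-! ### The run of the construction, computed from `X'` -/

theorem IsDelta2Collection.decidablePredIn {X : Set ℕ} {C : Set (Finset ℕ)}
    (h : IsDelta2Collection X C) :
    DecidablePredIn (setOracle (turingJump X)) fun n => finsetOfIndex n ∈ C :=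
  (IsDelta2In.decidablePredIn h).of_eq fun n =>
    ⟨fun ⟨F, hF, h⟩ => by rwa [← h, finsetOfIndex_canonicalIndex],
      fun h => ⟨_, h, canonicalIndex_finsetOfIndex n⟩⟩

theorem IsDelta2Function.computableIn {X : Set ℕ} {f : Finset ℕ → ℕ}
    (h : IsDelta2Function X f) :
    ComputableIn (setOracle (turingJump X)) fun n => f (finsetOfIndex n) := by
  have hmem : ∀ n v, Nat.pair n v ∈ Set.range (fun F => Nat.pair (canonicalIndex F) (f F)) ↔
      f (finsetOfIndex n) = v := by
    intro n v
    constructor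
    · rintro ⟨F, hF⟩
      obtain ⟨rfl, rfl⟩ := Nat.pair_eq_pair.1 hF
      rw [finsetOfIndex_canonicalIndex]
    · rintro rfl
      exact ⟨finsetOfIndex n, by simp only [canonicalIndex_finsetOfIndex]⟩
  have hd := (IsDelta2In.decidablePredIn h).comp
    (Primrec₂.natPair.comp (Primrec.fst (α := ℕ) (β := ℕ)) Primrec.snd).computableIn
  obtain ⟨g, hg, hg'⟩ := hd.exists_computableIn fun n => ⟨_, (hmem n _).2 rfl⟩
  exact hg.of_eq fun n => ((hmem n _).1 (hg' n)).symm

theorem onSide_add_onSide (i j : Bool) (a b E : ℕ) :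
    onSide i (a + onSide j E 0) (b + onSide j 0 E) = onSide i a b + if j = i then E else 0 := by
  cases i <;> cases j <;> simp [onSide]

/-- A sequence of states and actions that follows the rules of the construction. -/
structure IsRun (X : Set ℕ) (C : Bool → Set (Finset ℕ)) (f : Finset ℕ → ℕ)
    (st : ℕ → ℕ × ℕ × ℕ) (act : ℕ → ℕ) : Prop where
  zero : st 0 = (0, 0, 0)
  succ : ∀ t, st (t + 1) = nextState f (st t) (act t)
  valid : ∀ t, IsValidAct X C t (st t) (act t)

theorem exists_isRun {X : Set ℕ} {C : Bool → Set (Finset ℕ)} {f : Finset ℕ → ℕ}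
    (hdown : ∀ i, IsLowerSet (C i)) (hdelta : ∀ i, IsDelta2Collection X (C i))
    (hhyp : HyperimmuneWithin X X (C false ∪ C true)) (hf : IsDelta2Function X f) :
    ∃ st act, IsRun X C f st act ∧ ComputableIn (setOracle (turingJump X)) act := by
  obtain ⟨g, hg, hgv⟩ := (decidablePredIn_isValidAct (X := X)
    fun i => (hdelta i).decidablePredIn).exists_computableIn
      fun x : ℕ × ℕ × ℕ × ℕ => exists_isValidAct hdown hhyp x.1 x.2
  have h1 : ComputableIn (setOracle (turingJump X)) fun x : ℕ × ℕ × ℕ × ℕ => (x.2, g x) :=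
    ComputableIn.pair ComputableIn.snd hg
  have h2 := computableIn_nextState hf.computableIn
  have h3 := ComputableIn.comp h2 h1
  have h4 := ComputableIn.nat_rec_const h3 (0, 0, 0)
  let st : ℕ → ℕ × ℕ × ℕ :=
    fun n => Nat.rec (0, 0, 0) (fun t s => nextState f s (g (t, s))) n
  have h5 : ComputableIn (setOracle (turingJump X)) fun t => (t, st t) :=
    ComputableIn.pair ComputableIn.id h4
  have h6 : ComputableIn (setOracle (turingJump X)) fun t => g (t, st t) := by
    have h := ComputableIn.comp hg h5
    exact h
  exact ⟨st, fun t => g (t, st t), ⟨rfl, fun t => rfl, fun t => hgv (t, st t)⟩, h6⟩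

/-! ### Verification of the construction -/

namespace IsRun

variable {X : Set ℕ} {C : Bool → Set (Finset ℕ)} {f : Finset ℕ → ℕ} {st : ℕ → ℕ × ℕ × ℕ}
  {act : ℕ → ℕ}

/-- The index of the finite set built on side `i` before stage `t`. -/
def part (st : ℕ → ℕ × ℕ × ℕ) (i : Bool) (t : ℕ) : ℕ := onSide i (st t).1 (st t).2.1

/-- The set built on side `i`. -/
def limit (st : ℕ → ℕ × ℕ × ℕ) (i : Bool) : Set ℕ := {x | ∃ t, (part st i t).testBit x = true}

theorem part_succ (h : IsRun X C f st act) (i : Bool) (t : ℕ) :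
    part st i (t + 1) = part st i t + if actSide (act t) = i then actSet (act t) else 0 := by
  rw [part, h.succ]
  exact onSide_add_onSide _ _ _ _ _

theorem bound_succ (h : IsRun X C f st act) (t : ℕ) : (st (t + 1)).2.2 =
    (st t).2.2 + actUse (act t) + actSet (act t) + f (finsetOfIndex (actSet (act t))) + 1 := by
  rw [h.succ]
  rfl

theorem bound_mono (h : IsRun X C f st act) : Monotone fun t => (st t).2.2 :=
  monotone_nat_of_le_succ fun t => by
    rw [h.bound_succ]
    omega

theorem le_bound (h : IsRun X C f st act) (t : ℕ) : t ≤ (st t).2.2 := by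
  induction t with
  | zero => exact Nat.zero_le _
  | succ t ih =>
    rw [h.bound_succ]
    omega

theorem testBit_actSet (h : IsRun X C f st act) {t x : ℕ} (hx : (actSet (act t)).testBit x = true) :
    finsetOfIndex (actSet (act t)) ∈ C (actSide (act t)) ∧ x ∈ X ∧ (st t).2.2 ≤ x := by
  rcases h.valid t with hv | ⟨h0, -⟩
  · exact ⟨hv.1, hv.2.1.2 x hx⟩
  · simp [h0] at hx

theorem exists_part_eq (h : IsRun X C f st act) (i : Bool) {s t : ℕ} (hst : s ≤ t) :
    ∃ E, part st i t = part st i s + E ∧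
      (∀ x, E.testBit x = true → x ∈ X ∧ (st s).2.2 ≤ x ∧ x < (st t).2.2 ∧
        ∃ r < t, actSide (act r) = i ∧ (actSet (act r)).testBit x = true) := by
  induction t, hst using Nat.le_induction with
  | base => exact ⟨0, rfl, by simp⟩
  | succ t hst ih =>
    obtain ⟨E, hE, hE'⟩ := ih
    have hb := h.bound_succ t
    by_cases hi : actSide (act t) = i
    · refine ⟨E + actSet (act t), by rw [h.part_succ, if_pos hi, hE, add_assoc], fun x hx => ?_⟩
      -- No carries: `E` lies below the current bound, the new set at or above it.
      rw [testBit_add_of_disjoint fun y hy hy' =>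
        (hE' y hy).2.2.1.not_ge (h.testBit_actSet hy').2.2] at hx
      rcases hx with hx | hx
      · obtain ⟨h1, h2, h3, r, hr, h4⟩ := hE' x hx
        exact ⟨h1, h2, by omega, r, by omega, h4⟩
      · have h1 := h.testBit_actSet hx
        have h2 := lt_of_testBit hx
        exact ⟨h1.2.1, (h.bound_mono hst).trans h1.2.2, by omega, t, by omega, hi, hx⟩
    · refine ⟨E, by rw [h.part_succ, if_neg hi, hE, add_zero], fun x hx => ?_⟩
      obtain ⟨h1, h2, h3, r, hr, h4⟩ := hE' x hx
      exact ⟨h1, h2, by omega, r, by omega, h4⟩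

theorem part_zero (h : IsRun X C f st act) (i : Bool) : part st i 0 = 0 := by
  cases i <;> simp [part, onSide, h.zero]

theorem testBit_part (h : IsRun X C f st act) {i : Bool} {t x : ℕ}
    (hx : (part st i t).testBit x = true) :
    x < (st t).2.2 ∧ ∃ r < t, actSide (act r) = i ∧ (actSet (act r)).testBit x = true := by
  obtain ⟨E, hE, hE'⟩ := h.exists_part_eq i (Nat.zero_le t)
  rw [h.part_zero, zero_add] at hE
  exact (hE' x (hE ▸ hx)).2.2

theorem testBit_part_iff (h : IsRun X C f st act) (i : Bool) {s t x : ℕ} (hst : s ≤ t)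
    (hx : x < (st s).2.2) : (part st i t).testBit x = true ↔ (part st i s).testBit x = true := by
  obtain ⟨E, hE, hE'⟩ := h.exists_part_eq i hst
  rw [hE, testBit_add_of_disjoint fun y hy hy' =>
    ((h.testBit_part hy).1.not_ge (hE' y hy').2.1)]
  exact or_iff_left fun hx' => hx.not_ge (hE' x hx').2.1

/-- Later additions stay at or above the bound, so membership below it is already settled. -/
theorem mem_limit_iff (h : IsRun X C f st act) (i : Bool) {s x : ℕ} (hx : x < (st s).2.2) :
    x ∈ limit st i ↔ (part st i s).testBit x = true := by
  refine ⟨fun ⟨t, ht⟩ => ?_, fun hx => ⟨s, hx⟩⟩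
  rcases le_total s t with hst | hst
  · exact (h.testBit_part_iff i hst hx).1 ht
  · exact (h.testBit_part_iff i hst (h.testBit_part ht).1).2 ht

/-- An action that adds elements meets its requirement. -/
theorem meetsRequirement (h : IsRun X C f st act) {t : ℕ} (ht : actSet (act t) ≠ 0) :
    MeetsRequirement X (onSide (actSide (act t)) t.unpair.1 t.unpair.2)
      (part st (actSide (act t)) (t + 1)) (actUse (act t)) := by
  rcases h.valid t with hv | ⟨h0, -⟩
  · rw [h.part_succ, if_pos rfl]
    exact hv.2.2
  · exact absurd h0 ht

/-- The new bound exceeds `actUse`, so the finite computation that was found agrees with the limit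
forever. -/
theorem mem_turingJump_of_ne_zero (h : IsRun X C f st act) {t e : ℕ}
    (hk : onSide (actSide (act t)) t.unpair.1 t.unpair.2 = 2 * e) (ht : actSet (act t) ≠ 0) :
    e ∈ turingJump (setJoin (limit st (actSide (act t))) X) := by
  have hm := h.meetsRequirement ht
  rw [hk] at hm
  rcases hm with hm | hm
  · omega
  · rw [show 2 * e / 2 = e by omega] at hm
    refine hm.2.mem_turingJump fun x hx => h.mem_limit_iff _ ?_
    rw [h.bound_succ]
    omega

/-- If the program halted, a late enough finite part would already make it halt; what was added
since stage `t` would be a set above the raised bound meeting the requirement. Infinity of the limit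
makes that set non-empty. -/
theorem notMem_turingJump_of_eq_zero (h : IsRun X C f st act) {t e : ℕ}
    (hk : onSide (actSide (act t)) t.unpair.1 t.unpair.2 = 2 * e) (ht : actSet (act t) = 0)
    (hinf : (limit st (actSide (act t))).Infinite) :
    e ∉ turingJump (setJoin (limit st (actSide (act t))) X) := by
  intro he
  obtain ⟨u₀, hu₀⟩ := exists_haltsWithin he
  generalize hi : actSide (act t) = i at *
  have hneg : ∀ w : ℕ, ¬ Forces X (2 * e) (part st i t) ((st t).2.2 + actUse (act t))
      w.unpair.1 w.unpair.2 := by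
    rcases h.valid t with hv | ⟨-, hv⟩
    · exact absurd ht hv.2.1.1
    · simp only [hi, hk] at hv
      exact hv
  have hpart : part st i (t + 1) = part st i t := by
    rw [h.part_succ, ht]
    simp
  -- This element enters after stage `t`; it is what makes `E` below non-zero.
  obtain ⟨x, ⟨s, hs⟩, hx⟩ := hinf.exists_gt (st (t + 1)).2.2
  obtain ⟨s', hs', hu⟩ : ∃ s', max s (t + 1) ≤ s' ∧ u₀ ≤ s' :=
    ⟨max (max s (t + 1)) u₀, le_max_left _ _, le_max_right _ _⟩
  obtain ⟨u, hhalt⟩ := hu₀ (part st i s') fun x hx =>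
    h.mem_limit_iff i (hx.trans_le (hu.trans (h.le_bound s')))
  obtain ⟨E, hE, hE'⟩ := h.exists_part_eq i ((le_max_right s (t + 1)).trans hs')
  have hxs : (part st i s').testBit x = true :=
    (h.testBit_part_iff i ((le_max_left s (t + 1)).trans hs') (h.testBit_part hs).1).2 hs
  refine hneg (Nat.pair E u) ?_
  rw [Nat.unpair_pair]
  refine ⟨⟨?_, fun y hy => ⟨(hE' y hy).1, ?_⟩⟩, Or.inr ⟨by omega, ?_⟩⟩
  · rintro rfl
    rw [hE, add_zero] at hxs
    exact (h.testBit_part hxs).1.not_gt hx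
  · have := (hE' y hy).2.1
    rw [h.bound_succ] at this
    omega
  · rw [← hpart, ← hE, show 2 * e / 2 = e by omega]
    exact hhalt

/-- A requirement bounding the index from below is met, since `X` is infinite. -/
theorem le_part (h : IsRun X C f st act) (hX : X.Infinite) {t j : ℕ}
    (hk : onSide (actSide (act t)) t.unpair.1 t.unpair.2 = 2 * j + 1) :
    j ≤ part st (actSide (act t)) (t + 1) := by
  by_cases ht : actSet (act t) = 0
  · exfalso
    rcases h.valid t with hv | ⟨-, hv⟩
    · exact hv.2.1.1 ht
    · obtain ⟨x, hxX, hx⟩ := hX.exists_gt (max ((st t).2.2 + actUse (act t)) j)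
      -- The singleton `{x}` has index `2 ^ x > j`; the use is irrelevant to an odd requirement,
      -- hence `0`.
      refine hv (Nat.pair (2 ^ x) 0) ?_
      rw [Nat.unpair_pair, hk]
      refine ⟨⟨by positivity, fun y hy => ?_⟩, Or.inl ⟨by omega, ?_⟩⟩
      · rw [Nat.testBit_two_pow] at hy
        have : x = y := by simpa using hy
        exact ⟨this ▸ hxX, by omega⟩
      · have := x.lt_two_pow_self
        simp only
        omega
  · have hm := h.meetsRequirement ht
    rw [hk] at hm
    rcases hm with hm | hm <;> omega

theorem limit_infinite (h : IsRun X C f st act) (hX : X.Infinite) {i : Bool}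
    (hi : ∀ k, ∃ t, actSide (act t) = i ∧ onSide i t.unpair.1 t.unpair.2 = k) :
    (limit st i).Infinite := by
  intro hfin
  -- A finite limit would bound the index of every part; this requirement exceeds that bound by one.
  obtain ⟨t, ht, hk⟩ := hi (2 * (canonicalIndex hfin.toFinset + 1) + 1)
  subst ht
  have h1 := h.le_part hX hk
  have h2 : part st (actSide (act t)) (t + 1) ≤ canonicalIndex hfin.toFinset := by
    conv_lhs => rw [← canonicalIndex_finsetOfIndex (part st _ _)]
    refine Finset.sum_le_sum_of_subset fun x hx => ?_
    rw [Set.Finite.mem_toFinset]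
    exact ⟨t + 1, mem_finsetOfIndex.1 hx⟩
  omega

/-- `X'` searches for a stage `g e` treating `2 * e` on side `i`; whether that action is empty
decides the jump at `e`. -/
theorem lowOver_limit (h : IsRun X C f st act) (hX : X.Infinite)
    (hact : ComputableIn (setOracle (turingJump X)) act) {i : Bool}
    (hi : ∀ k, ∃ t, actSide (act t) = i ∧ onSide i t.unpair.1 t.unpair.2 = k) :
    LowOver (limit st i) X := by
  have hinf := h.limit_infinite hX hi
  have h1 : PrimrecPred fun y : (ℕ × ℕ) × ℕ =>
      actSide y.2 = i ∧ onSide i y.1.2.unpair.1 y.1.2.unpair.2 = 2 * y.1.1 := by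
    have ht : Primrec fun y : (ℕ × ℕ) × ℕ => y.1.2.unpair :=
      Primrec.unpair.comp (Primrec.snd.comp Primrec.fst)
    exact (Primrec.eq.comp (primrec_actSide.comp Primrec.snd) (Primrec.const i)).and
      (Primrec.eq.comp (primrec_onSide (Primrec.const i) (Primrec.fst.comp ht)
        (Primrec.snd.comp ht)) (Primrec.nat_mul.comp (Primrec.const 2)
          (Primrec.fst.comp Primrec.fst)))
  have h2 : ComputableIn (setOracle (turingJump X)) fun x : ℕ × ℕ => (x, act x.2) :=
    ComputableIn.pair ComputableIn.id (hact.comp ComputableIn.snd)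
  obtain ⟨g, hg, hg'⟩ := ((DecidablePredIn.of_primrec h1).comp h2).exists_computableIn
    fun e => hi (2 * e)
  have h3 : PrimrecPred fun v : ℕ => ¬ actSet v = 0 :=
    (Primrec.eq.comp primrec_actSet (Primrec.const 0)).not
  have h4 : ComputableIn (setOracle (turingJump X)) fun e => act (g e) := hact.comp hg
  refine setTuringLE_iff.2 (((DecidablePredIn.of_primrec h3).comp h4).of_eq fun e => ?_)
  obtain ⟨h5, h6⟩ := hg' e
  simp only at h5 h6
  rw [← h5] at h6 hinf ⊢
  exact ⟨fun h0 => h.mem_turingJump_of_ne_zero h6 h0,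
    fun he h0 => h.notMem_turingJump_of_eq_zero h6 h0 hinf he⟩

/-- If each side missed a requirement, the stage coding the two missed ones would have to treat one
of them. -/
theorem exists_side (act : ℕ → ℕ) :
    ∃ i, ∀ k, ∃ t, actSide (act t) = i ∧ onSide i t.unpair.1 t.unpair.2 = k := by
  by_contra! hno
  obtain ⟨k₀, h0⟩ := hno false
  obtain ⟨k₁, h1⟩ := hno true
  cases hs : actSide (act (Nat.pair k₀ k₁)) with
  | false => exact h0 _ hs (by simp [onSide])
  | true => exact h1 _ hs (by simp [onSide])

end IsRun

/-! ### The theorem -/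

theorem mainTheorem9 (X : Set ℕ) (hX : X.Infinite)
    (C : Fin 2 → Set (Finset ℕ))
    (hdown : ∀ i, IsLowerSet (C i))
    (hdelta : ∀ i, IsDelta2Collection X (C i))
    (hhyp : HyperimmuneWithin X X (C 0 ∪ C 1))
    (f : Finset ℕ → ℕ) (hf : IsDelta2Function X f) :
    ∃ i : Fin 2, ∃ F : ℕ → Finset ℕ,
      (∀ s, (F s).Nonempty) ∧
      (∀ s, F s ∈ C i) ∧
      (∀ s, (F s : Set ℕ) ⊆ X) ∧
      (∀ s, ∀ x ∈ F s, ∀ y ∈ F (s + 1), x < y) ∧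
      (∀ s, ∀ y ∈ F (s + 1), f (F s) < y) ∧
      ∃ G : Set ℕ, G.Infinite ∧ G ⊆ ⋃ s, (F s : Set ℕ) ∧ LowOver G X := by
  obtain ⟨st, act, h, hact⟩ := exists_isRun (C := fun b => C (cond b 1 0)) (fun i => hdown _)
    (fun i => hdelta _) hhyp hf
  obtain ⟨i, hi⟩ := IsRun.exists_side act
  have hinf := h.limit_infinite hX hi
  let P : ℕ → Prop := fun t => actSide (act t) = i ∧ actSet (act t) ≠ 0
  -- The infinite limit is covered by the finite sets added at the stages in `P`.
  have hP : {t | P t}.Infinite := by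
    intro hfin
    refine hinf ((hfin.biUnion (t := fun t => ((finsetOfIndex (actSet (act t)) : Finset ℕ) : Set ℕ))
      fun t _ => Finset.finite_toSet _).subset ?_)
    rintro x ⟨t, ht⟩
    obtain ⟨-, r, -, hr, hx⟩ := h.testBit_part ht
    refine Set.mem_biUnion (x := r) ⟨hr, ?_⟩ (Finset.mem_coe.2 (mem_finsetOfIndex.2 hx))
    intro h0
    simp [h0] at hx
  have hnth : ∀ s, P (Nat.nth P s) := Nat.nth_mem_of_infinite hP
  have hlt : ∀ s, Nat.nth P s + 1 ≤ Nat.nth P (s + 1) := fun s =>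
    Nat.nth_strictMono hP (Nat.lt_succ_self s)
  have hle : ∀ s, ∀ y ∈ finsetOfIndex (actSet (act (Nat.nth P (s + 1)))),
      (st (Nat.nth P s + 1)).2.2 ≤ y := fun s y hy =>
    (h.bound_mono (hlt s)).trans (h.testBit_actSet (mem_finsetOfIndex.1 hy)).2.2
  refine ⟨cond i 1 0, fun s => finsetOfIndex (actSet (act (Nat.nth P s))),
    fun s => finsetOfIndex_nonempty (hnth s).2, fun s => ?_, fun s x hx => ?_,
    fun s x hx y hy => ?_, fun s y hy => ?_, IsRun.limit st i, hinf, ?_, h.lowOver_limit hX hact hi⟩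
  · obtain ⟨x, hx⟩ := finsetOfIndex_nonempty (hnth s).2
    have := (h.testBit_actSet (mem_finsetOfIndex.1 hx)).1
    rwa [(hnth s).1] at this
  · exact (h.testBit_actSet (mem_finsetOfIndex.1 hx)).2.1
  · have h1 := hle s y hy
    -- `x` is below the index of its set, and the next bound includes that index.
    have h2 := lt_of_testBit (mem_finsetOfIndex.1 hx)
    rw [h.bound_succ] at h1
    omega
  · have h1 := hle s y hy
    rw [h.bound_succ] at h1
    change f (finsetOfIndex (actSet (act (Nat.nth P s)))) < y
    omega
  · classical
    rintro x ⟨t, ht⟩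
    obtain ⟨-, r, -, hr, hx⟩ := h.testBit_part ht
    have hPr : P r := ⟨hr, fun h0 => by simp [h0] at hx⟩
    -- Stage `r` is the `Nat.count P r`-th stage in `P`.
    refine Set.mem_iUnion.2 ⟨Nat.count P r, ?_⟩
    simp only [Finset.mem_coe]
    rw [Nat.nth_count hPr]
    exact mem_finsetOfIndex.2 hx
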